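/- Setting. A single item is sold to $n$ bidders. A mechanism $M=(x,p)$ assigns to each reported profile $\mathbf v\in[0,\infty)^n$ winning probabilities $x_i(\mathbf v)\ge 0$ with $\sum_i x_i(\mathbf v)\le 1$ and payments $p_i(\mathbf v)$; only mechanisms that are dominant strategy incentive compatible (DSIC) and individually rational (IR) are considered. For a product distribution $\mathbf D=D^1\times\dots\times D^n$ write $\mathrm{Rev}(M,\mathbf D)=\mathbb E_{\mathbf v\sim\mathbf D}\big[\sum_i p_i(\mathbf v)\big]$ and $\mathrm{OPT}(\mathbf D)=\sup_M \mathrm{Rev}(M,\mathbf D)$, the supremum being over all DSIC and IR mechanisms. For $0<\epsilon<1$ let $\lfloor v\rfloor_\epsilon$ denote the largest power $(1-\epsilon)^k$, $k\in\mathbb Z$, that is at most $v$ (and $\lfloor v\rfloor_\epsilon=0$ if $v=0$). The empirical Myerson auction $M_S$ learned from samples $S=(\mathbf v_1,\dots,\mathbf v_m)$ of value profiles is the following mechanism. Let $E^i$ be the uniform distribution over $\lfloor v_{1i}\rfloor_\epsilon,\dots,\lfloor v_{mi}\rfloor_\epsilon$. Treat every report $v$ as $\lfloor v\rfloor_\epsilon$,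 and run Myerson's optimal auction for $E^1\times\dots\times E^n$: the item goes to the bidder with the highest ironed virtual value if that is nonnegative (ties go to the smallest index), and the winner pays the lowest report with which she would still win. Here the ironed virtual value of a point of the support of $E^i$ is the slope, on the quantile interval of that point, of the least concave majorant of the revenue curve of $E^i$; a report outside the support is treated as the largest support point below it, and never wins if there is none. Theorem. Let $h\ge 1$, $0<\epsilon<1$, and let $\mathbf D=D^1\times\dots\times D^n$ be a product distribution with support in $[1,h]^n$. (1) If $\mathbf D''$ is obtained from $\mathbf D$ by replacing every value $v$ by $\lfloor v\rfloor_\epsilon$, then $\mathrm{OPT}(\mathbf D'')\ge(1-\epsilon)\,\mathrm{OPT}(\mathbf D)$. (2) For every number $m$ of samples and every $S$, the mechanism $M_S$ is feasible, DSIC and IR. (3) There is a universal constant $C>0$ (independent of $n,h,\epsilon,\gamma,m,\mathbf D$) such that the following holds for $m$ i.i.d. samples $S$ from $\mathbf D$. Put $$N=\frac{hn}{\epsilon^{3}}\,(1+\log h)\Big(1+\log\frac{n(1+\log h)}{\epsilon}\Big)=\tilde O(hn\epsilon^{-3}).$$ (a) For every $0<\gamma<1$, if $m\ge C\big(N+h\epsilon^{-2}\log\frac1\gamma\big)$,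 then with probability at least $1-\gamma$ over $S$, $\mathrm{Rev}(M_S,\mathbf D)\ge(1-C\epsilon)\,\mathrm{OPT}(\mathbf D)$. (b) If $m\ge CN$, then $\mathbb E_S\big[\mathrm{Rev}(M_S,\mathbf D)\big]\ge(1-C\epsilon)\,\mathrm{OPT}(\mathbf D)$. -/

import Mathlib

open MeasureTheory

noncomputable section

/-! ### Single-item auctions with `n` bidders -/

/-- A direct revelation mechanism: `x v i` is the probability that bidder `i` wins and `p v i` is
her payment when the reported value profile is `v`. -/
structure Mechanism (n : ℕ) where
  x : (Fin n → ℝ) → Fin n → ℝ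
  p : (Fin n → ℝ) → Fin n → ℝ

namespace Mechanism

variable {n : ℕ}

/-- There is one item: the winning probabilities are nonnegative and add up to at most one. -/
def IsFeasible (M : Mechanism n) : Prop :=
  ∀ v : Fin n → ℝ, 0 ≤ v → (∀ i, 0 ≤ M.x v i) ∧ ∑ i, M.x v i ≤ 1

/-- Dominant strategy incentive compatibility: whatever the others report, reporting her true
value `v i` is at least as good for bidder `i` as any other report `b`. -/
def IsDSIC (M : Mechanism n) : Prop :=
  ∀ v : Fin n → ℝ, 0 ≤ v → ∀ i : Fin n, ∀ b : ℝ, 0 ≤ b →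
    v i * M.x (Function.update v i b) i - M.p (Function.update v i b) i
      ≤ v i * M.x v i - M.p v i

/-- Individual rationality: truthful bidders never have negative utility. -/
def IsIR (M : Mechanism n) : Prop :=
  ∀ v : Fin n → ℝ, 0 ≤ v → ∀ i : Fin n, 0 ≤ v i * M.x v i - M.p v i

/-- The mechanisms under consideration: (measurable) single-item, DSIC and IR. -/
structure IsAdmissible (M : Mechanism n) : Prop where
  measurable_x : Measurable M.x
  measurable_p : Measurable M.p
  feasible : M.IsFeasible
  dsic : M.IsDSIC
  ir : M.IsIR

/-- The expected revenue of `M` when the values are drawn from the product distribution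
`D 0 × ⋯ × D (n - 1)`. -/
def rev (M : Mechanism n) (D : Fin n → Measure ℝ) : ℝ :=
  ∫ v, ∑ i, M.p v i ∂(Measure.pi D)

end Mechanism

/-- The optimal expected revenue for the product distribution `D 0 × ⋯ × D (n - 1)`. -/
def optRev {n : ℕ} (D : Fin n → Measure ℝ) : ℝ :=
  sSup {r : ℝ | ∃ M : Mechanism n, M.IsAdmissible ∧
    Integrable (fun v => ∑ i, M.p v i) (Measure.pi D) ∧ r = M.rev D}

/-! ### Myerson's auction for finitely supported distributions -/

/-- The value at quantile `q`: the highest price at which a bidder with value distribution `μ`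
buys with probability at least `q`. -/
def valueAtQuantile (μ : Measure ℝ) (q : ℝ) : ℝ :=
  sSup {w : ℝ | q ≤ μ.real (Set.Ici w)}

/-- The revenue curve in quantile space. -/
def revenueCurve (μ : Measure ℝ) (q : ℝ) : ℝ :=
  q * valueAtQuantile μ q

/-- The ironed revenue curve: the least concave majorant of the revenue curve on `[0, 1]`. -/
def ironedRevenueCurve (μ : Measure ℝ) (q : ℝ) : ℝ :=
  sInf {y : ℝ | ∃ g : ℝ → ℝ, ConcaveOn ℝ (Set.Icc 0 1) g ∧
    (∀ t ∈ Set.Icc (0 : ℝ) 1, revenueCurve μ t ≤ g t) ∧ y = g q}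

/-- The ironed virtual value of an atom `w` of `μ`: the slope of the ironed revenue curve on the
quantile interval `[μ (w, ∞), μ [w, ∞)]` that belongs to `w`. -/
def ironedVirtualValue (μ : Measure ℝ) (w : ℝ) : ℝ :=
  (ironedRevenueCurve μ (μ.real (Set.Ici w)) - ironedRevenueCurve μ (μ.real (Set.Ioi w)))
    / μ.real {w}

open Classical in
/-- The ironed virtual value of an arbitrary report `v`. A report that is not in the (finite)
support of `μ` is treated as the highest support point below it, and as `⊥` (never winning) if
there is no such point. -/
def reportVirtualValue (μ : Measure ℝ) (v : ℝ) : EReal :=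
  if ∃ w, w ≤ v ∧ 0 < μ.real {w} then
    (ironedVirtualValue μ (sSup {w : ℝ | w ≤ v ∧ 0 < μ.real {w}}) : EReal)
  else ⊥

/-- Bidder `i` wins Myerson's auction: her ironed virtual value is nonnegative and the highest,
ties being broken in favour of the bidder with the smaller index. -/
def MyersonWins {n : ℕ} (E : Fin n → Measure ℝ) (v : Fin n → ℝ) (i : Fin n) : Prop :=
  0 ≤ reportVirtualValue (E i) (v i) ∧
    ∀ j, reportVirtualValue (E j) (v j) < reportVirtualValue (E i) (v i) ∨
      (reportVirtualValue (E j) (v j) = reportVirtualValue (E i) (v i) ∧ i ≤ j)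

open Classical in
/-- Myerson's auction with respect to the product distribution `E 0 × ⋯ × E (n - 1)` (each `E i`
finitely supported): the winner pays the lowest report with which she would still win. -/
def myersonAuction {n : ℕ} (E : Fin n → Measure ℝ) : Mechanism n where
  x v i := if MyersonWins E v i then 1 else 0
  p v i := if MyersonWins E v i then
    sInf {t : ℝ | 0 ≤ t ∧ MyersonWins E (Function.update v i t) i} else 0

/-! ### The empirical Myerson auction on rounded values -/

/-- The value `v > 0` rounded down to the closest (integer) power of `1 - ε`; it is `0` for
`v ≤ 0`. -/
def roundDown (ε v : ℝ) : ℝ :=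
  sSup {w : ℝ | w ≤ v ∧ ∃ k : ℤ, w = (1 - ε) ^ k}

theorem monotone_roundDown {ε : ℝ} (hε : ε < 1) : Monotone (roundDown ε) := by
  intro v w hvw
  unfold roundDown
  rcases Set.eq_empty_or_nonempty {u : ℝ | u ≤ v ∧ ∃ k : ℤ, u = (1 - ε) ^ k} with h | h
  · rw [h, Real.sSup_empty]
    apply Real.sSup_nonneg
    rintro u ⟨-, k, rfl⟩
    exact (zpow_pos (by linarith) k).le
  · exact csSup_le_csSup ⟨w, fun u hu => hu.1⟩ h fun u hu => ⟨hu.1.trans hvw, hu.2⟩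

theorem measurable_roundDown {ε : ℝ} (hε : ε < 1) : Measurable (roundDown ε) :=
  (monotone_roundDown hε).measurable

/-- The empirical distribution: the uniform distribution over the samples `s 0, …, s (m - 1)`. -/
def empiricalMeasure {m : ℕ} (s : Fin m → ℝ) : Measure ℝ :=
  (m : ENNReal)⁻¹ • ∑ j, Measure.dirac (s j)

/-- The mechanism learned from the samples `S 0, …, S (m - 1)` (each a value profile): round all
sampled values down to powers of `1 - ε`, take Myerson's auction with respect to the product of
the bidders' empirical distributions, and run it with every report treated as the closest power of
`1 - ε` from below. -/
def empiricalMyerson (ε : ℝ) {n m : ℕ} (S : Fin m → Fin n → ℝ) : Mechanism n where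
  x v := (myersonAuction fun i => empiricalMeasure fun j => roundDown ε (S j i)).x
    fun i => roundDown ε (v i)
  p v := (myersonAuction fun i => empiricalMeasure fun j => roundDown ε (S j i)).p
    fun i => roundDown ε (v i)

/-- The law of `m` independent samples from the product distribution `D 0 × ⋯ × D (n - 1)`. -/
def sampleLaw {n : ℕ} (D : Fin n → Measure ℝ) (m : ℕ) : Measure (Fin m → Fin n → ℝ) :=
  Measure.pi fun _ => Measure.pi D

/-- The sample size up to a constant, without its dependence on the failure probability:
`h n ε⁻³` times logarithmic factors. -/
def sampleSize (n : ℕ) (h ε : ℝ) : ℝ :=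
  h * n / ε ^ 3 * (1 + Real.log h) * (1 + Real.log (n * (1 + Real.log h) / ε))

end

/-!
The empirical Myerson auction is nearly optimal because it maximizes an empirical revenue over a
finite class of auctions, and empirical revenues concentrate uniformly over that class.

*Myerson's theory.* For a bidder with a finitely supported distribution, the ironed revenue curve is
a concave majorant of the revenue curve, so the ironed virtual value is monotone
(`IsCarriedBy.virtualValue_mono`) and its partial sums over upper parts of the support are points of
the ironed curve (`IsCarriedBy.sum_virtualValue`). A threshold price at which the virtual value jumps
earns exactly the ironed virtual surplus, since the revenue curve touches its majorant there
(`IsCarriedBy.ironed_le_of_jump`); hence the revenue of Myerson's auction is at least its ironed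
virtual surplus (`virtualSurplus_le_rev`). Conversely, the allocation of a DSIC and IR mechanism to
one bidder is a mixture of posted prices, so its revenue is at most its ironed virtual surplus
(`mul_integral_payment_le`). The upper bound is proved for values that are rounded by a monotone map
`r` with `c * v ≤ r v`, at the loss of a factor `c`
(`Mechanism.IsAdmissible.mul_rev_le_myerson`). With `c = 1 - ε` this is the first claim, for
arbitrary distributions, and with `r = id` it is the optimality of Myerson's auction for the
empirical distributions.

*Concentration.* The expectation of a function under the product of the coordinatewise empirical
distributions is an average, over shifts of the coordinates, of means of `m` independent copies. By
convexity its exponential moments are bounded by those of such a mean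
(`integral_exp_productMean_le`), which gives multiplicative Chernoff bounds with exponent
`m * ε ^ 2 / h`.

*Counting.* On the grid of powers of `1 - ε` in `[1, h]`, the outcome of Myerson's auction depends
only on the order of the virtual values, so there are at most `(n K + 1) ^ (n K)` revenue functions,
where `K ≤ (1 + log h) / ε` is the size of the grid (`exists_table`, `card_powerGrid_le`). A union
bound over them shows that the empirical optimum is within a factor `1 - 5 * ε` of the true one
(`measure_rev_lt_le`). The bound in expectation follows with failure probability `ε`.
-/

/-! ### Rounding down to powers of `1 - ε` -/

theorem roundDown_of_nonpos {ε v : ℝ} (hε : ε < 1) (hv : v ≤ 0) : roundDown ε v = 0 := by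
  have : {w : ℝ | w ≤ v ∧ ∃ k : ℤ, w = (1 - ε) ^ k} = ∅ := by
    ext w
    simp only [Set.mem_ofPred_eq, Set.mem_empty_iff_false, iff_false, not_and]
    rintro hw ⟨k, rfl⟩
    exact absurd (zpow_pos (by linarith : (0 : ℝ) < 1 - ε) k) (by linarith)
  rw [roundDown, this, Real.sSup_empty]

theorem roundDown_eq_zpow {ε v : ℝ} (h0 : 0 < ε) (h1 : ε < 1) {k : ℤ} (hk : (1 - ε) ^ k ≤ v)
    (hk' : v < (1 - ε) ^ (k - 1)) : roundDown ε v = (1 - ε) ^ k := by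
  have hb : 0 < 1 - ε := by linarith
  refine IsGreatest.csSup_eq ⟨⟨hk, k, rfl⟩, ?_⟩
  rintro w ⟨hw, j, rfl⟩
  have h : ((1 - ε) ^ j : ℝ) < (1 - ε) ^ (k - 1) := hw.trans_lt hk'
  rw [zpow_lt_zpow_iff_right_of_lt_one₀ hb (by linarith)] at h
  exact (zpow_le_zpow_iff_right_of_lt_one₀ hb (by linarith)).2 (by omega)

theorem exists_roundDown_eq_zpow {ε v : ℝ} (h0 : 0 < ε) (h1 : ε < 1) (hv : 0 < v) :
    ∃ k : ℤ, roundDown ε v = (1 - ε) ^ k ∧ (1 - ε) ^ k ≤ v ∧ v < (1 - ε) ^ (k - 1) := by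
  have hb : 0 < 1 - ε := by linarith
  obtain ⟨k, hk, hk'⟩ := exists_mem_Ico_zpow hv ((one_lt_inv₀ hb).2 (by linarith))
  rw [inv_zpow'] at hk hk'
  rw [neg_add'] at hk'
  exact ⟨-k, roundDown_eq_zpow h0 h1 hk hk', hk, hk'⟩

theorem roundDown_zpow {ε : ℝ} (h0 : 0 < ε) (h1 : ε < 1) (k : ℤ) :
    roundDown ε ((1 - ε) ^ k) = (1 - ε) ^ k :=
  roundDown_eq_zpow h0 h1 le_rfl
    ((zpow_lt_zpow_iff_right_of_lt_one₀ (by linarith) (by linarith)).2 (by omega))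

theorem roundDown_roundDown {ε : ℝ} (h0 : 0 < ε) (h1 : ε < 1) (v : ℝ) :
    roundDown ε (roundDown ε v) = roundDown ε v := by
  rcases le_or_gt v 0 with hv | hv
  · rw [roundDown_of_nonpos h1 hv, roundDown_of_nonpos h1 le_rfl]
  · obtain ⟨k, hk, -⟩ := exists_roundDown_eq_zpow h0 h1 hv
    rw [hk, roundDown_zpow h0 h1]

theorem roundDown_nonneg {ε : ℝ} (h1 : ε < 1) (v : ℝ) : 0 ≤ roundDown ε v := by
  apply Real.sSup_nonneg
  rintro w ⟨-, k, rfl⟩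
  exact (zpow_pos (by linarith) k).le

theorem roundDown_le {ε : ℝ} (h0 : 0 < ε) (h1 : ε < 1) {v : ℝ} (hv : 0 ≤ v) :
    roundDown ε v ≤ v := by
  rcases hv.eq_or_lt with rfl | hv
  · rw [roundDown_of_nonpos h1 le_rfl]
  · obtain ⟨k, hk, hk', -⟩ := exists_roundDown_eq_zpow h0 h1 hv
    rwa [hk]

theorem mul_le_roundDown {ε : ℝ} (h0 : 0 < ε) (h1 : ε < 1) {v : ℝ} (hv : 0 ≤ v) :
    (1 - ε) * v ≤ roundDown ε v := by
  have hb : 0 < 1 - ε := by linarith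
  rcases hv.eq_or_lt with rfl | hv
  · rw [roundDown_of_nonpos h1 le_rfl, mul_zero]
  · obtain ⟨k, hk, -, hk'⟩ := exists_roundDown_eq_zpow h0 h1 hv
    rw [hk]
    calc (1 - ε) * v ≤ (1 - ε) * (1 - ε) ^ (k - 1) := by gcongr
      _ = (1 - ε) ^ k := by rw [← zpow_one_add₀ hb.ne']; congr 1; ring

theorem countable_range_roundDown {ε : ℝ} (h0 : 0 < ε) (h1 : ε < 1) :
    (Set.range (roundDown ε)).Countable := by
  refine ((Set.countable_range fun k : ℤ => (1 - ε) ^ k).insert 0).mono ?_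
  rintro _ ⟨v, rfl⟩
  rcases le_or_gt v 0 with hv | hv
  · exact Or.inl (roundDown_of_nonpos h1 hv)
  · obtain ⟨k, hk, -⟩ := exists_roundDown_eq_zpow h0 h1 hv
    exact Or.inr ⟨k, hk.symm⟩

/-- A function of finitely many rounded values is measurable, whatever the function. -/
theorem measurable_comp_roundDown {ε : ℝ} (h0 : 0 < ε) (h1 : ε < 1) {ι β γ : Type*} [Fintype ι]
    [MeasurableSpace γ] [MeasurableSpace β] (F : (ι → ℝ) → β) {u : γ → ι → ℝ}
    (hu : Measurable u) : Measurable fun c => F fun i => roundDown ε (u c i) := by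
  set f : γ → ι → ℝ := fun c i => roundDown ε (u c i) with hf
  have hfm : Measurable f := measurable_pi_lambda _ fun i =>
    (measurable_roundDown h1).comp ((measurable_pi_apply i).comp hu)
  have hc : (Set.range f).Countable := by
    refine (Set.countable_univ_pi (s := fun _ : ι => Set.range (roundDown ε))
      fun i => countable_range_roundDown h0 h1).mono ?_
    rintro _ ⟨c, rfl⟩ i -
    exact ⟨_, rfl⟩
  intro s _
  have : (fun c => F (f c)) ⁻¹' s = ⋃ y ∈ Set.range f ∩ F ⁻¹' s, f ⁻¹' {y} := by
    ext c
    simp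
  rw [this]
  exact MeasurableSet.biUnion (hc.mono Set.inter_subset_left) fun y _ =>
    hfm (measurableSet_singleton y)

/-- The powers of `1 - ε` in `[1, h]`. The range of exponents is large enough because
`ε ≤ -log (1 - ε)`. -/
noncomputable def powerGrid (h ε : ℝ) : Finset ℝ :=
  ((Finset.range (⌊Real.log h / ε⌋₊ + 1)).image fun k : ℕ => (1 - ε) ^ (-(k : ℤ))).filter (· ≤ h)

theorem le_of_mem_powerGrid {h ε g : ℝ} (hg : g ∈ powerGrid h ε) : g ≤ h :=
  (Finset.mem_filter.1 hg).2

theorem one_le_of_mem_powerGrid {h ε g : ℝ} (h0 : 0 < ε) (h1 : ε < 1) (hg : g ∈ powerGrid h ε) :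
    1 ≤ g := by
  obtain ⟨k, -, rfl⟩ := Finset.mem_image.1 (Finset.mem_filter.1 hg).1
  rw [zpow_neg, zpow_natCast]
  exact (one_le_inv₀ (pow_pos (by linarith) k)).2 (pow_le_one₀ (by linarith) (by linarith))

theorem roundDown_of_mem_powerGrid {h ε g : ℝ} (h0 : 0 < ε) (h1 : ε < 1)
    (hg : g ∈ powerGrid h ε) : roundDown ε g = g := by
  obtain ⟨k, -, rfl⟩ := Finset.mem_image.1 (Finset.mem_filter.1 hg).1
  exact roundDown_zpow h0 h1 _

theorem roundDown_mem_powerGrid {h ε v : ℝ} (h0 : 0 < ε) (h1 : ε < 1) (hv : v ∈ Set.Icc 1 h) :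
    roundDown ε v ∈ powerGrid h ε := by
  have hb : 0 < 1 - ε := by linarith
  obtain ⟨k, hk, hkv, hvk⟩ := exists_roundDown_eq_zpow h0 h1 (zero_lt_one.trans_le hv.1)
  have hk0 : k ≤ 0 := by
    have : ((1 - ε) ^ (0 : ℤ) : ℝ) < (1 - ε) ^ (k - 1) := by
      rw [zpow_zero]; exact hv.1.trans_lt hvk
    rw [zpow_lt_zpow_iff_right_of_lt_one₀ hb (by linarith)] at this
    omega
  obtain ⟨j, rfl⟩ : ∃ j : ℕ, k = -(j : ℤ) := ⟨k.natAbs, by omega⟩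
  refine Finset.mem_filter.2 ⟨Finset.mem_image.2 ⟨j, ?_, hk.symm⟩, hk ▸ hkv.trans hv.2⟩
  rw [Finset.mem_range, Nat.lt_succ_iff]
  apply Nat.le_floor
  rw [le_div_iff₀ h0]
  have h2 := Real.log_le_log (zpow_pos hb _) (hkv.trans hv.2)
  rw [Real.log_zpow] at h2
  have h3 := Real.log_le_sub_one_of_pos hb
  push_cast at h2
  nlinarith [(Nat.cast_nonneg j : (0 : ℝ) ≤ j)]

theorem card_powerGrid_le {h ε : ℝ} (hh : 1 ≤ h) (h0 : 0 < ε) (h1 : ε < 1) :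
    ((powerGrid h ε).card : ℝ) ≤ (1 + Real.log h) / ε := by
  have hl := Real.log_nonneg hh
  calc ((powerGrid h ε).card : ℝ) ≤ (⌊Real.log h / ε⌋₊ + 1 : ℕ) := by
        exact_mod_cast (Finset.card_filter_le _ _).trans
          (Finset.card_image_le.trans (Finset.card_range _).le)
    _ ≤ Real.log h / ε + 1 := by
        push_cast
        gcongr
        exact Nat.floor_le (by positivity)
    _ ≤ (1 + Real.log h) / ε := by
        rw [add_div, add_comm]
        gcongr
        exact (one_le_div h0).2 h1.le

/-! ### The ironed revenue curve of a finitely supported distribution -/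

/-- `μ` is a probability measure carried by the finite set `G` of nonnegative reals. -/
structure IsCarriedBy (μ : Measure ℝ) (G : Finset ℝ) : Prop where
  isProb : IsProbabilityMeasure μ
  nonneg : ∀ g ∈ G, 0 ≤ g
  compl_null : μ (G : Set ℝ)ᶜ = 0

namespace IsCarriedBy

variable {μ : Measure ℝ} {G : Finset ℝ}

theorem exists_mem_of_pos (hμ : IsCarriedBy μ G) {s : Set ℝ} (hs : 0 < μ.real s) :
    ∃ g ∈ G, g ∈ s := by
  by_contra! hc
  have : μ s = 0 := measure_mono_null (fun x hx => fun hxG => hc x hxG hx) hμ.compl_null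
  rw [measureReal_def, this] at hs
  simp at hs

theorem mem_of_pos (hμ : IsCarriedBy μ G) {w : ℝ} (hw : 0 < μ.real {w}) : w ∈ G := by
  obtain ⟨g, hg, rfl⟩ := hμ.exists_mem_of_pos hw
  exact hg

theorem measureReal_Ici (hμ : IsCarriedBy μ G) (w : ℝ) :
    μ.real (Set.Ici w) = μ.real (Set.Ioi w) + μ.real {w} := by
  have := hμ.isProb
  rw [← Set.Ioi_union_left, measureReal_union (by simp) (measurableSet_singleton w)]

theorem Ici_zero (hμ : IsCarriedBy μ G) : μ.real (Set.Ici 0) = 1 := by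
  have := hμ.isProb
  rw [measureReal_def, (mem_ae_iff_prob_eq_one measurableSet_Ici).1, ENNReal.toReal_one]
  exact measure_mono_null (fun x hx hxG => hx (hμ.nonneg x hxG)) hμ.compl_null

/-- A bound for all values. -/
theorem exists_bound (hμ : IsCarriedBy μ G) : ∃ B : ℝ, 0 ≤ B ∧ ∀ g ∈ G, g ≤ B :=
  ⟨∑ g ∈ G, g, Finset.sum_nonneg hμ.nonneg, fun _ hg =>
    Finset.single_le_sum (f := fun g : ℝ => g) (fun g hg => hμ.nonneg g hg) hg⟩

theorem bddAbove_quantile (hμ : IsCarriedBy μ G) {t : ℝ} (ht : 0 < t) :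
    BddAbove {w : ℝ | t ≤ μ.real (Set.Ici w)} := by
  obtain ⟨B, -, hB⟩ := hμ.exists_bound
  refine ⟨B, fun w hw => ?_⟩
  obtain ⟨g, hg, hwg⟩ := hμ.exists_mem_of_pos (ht.trans_le hw)
  exact le_trans hwg (hB g hg)

theorem mul_le_revenueCurve (hμ : IsCarriedBy μ G) {t w : ℝ} (ht : 0 ≤ t)
    (htw : t ≤ μ.real (Set.Ici w)) : t * w ≤ revenueCurve μ t := by
  rcases ht.eq_or_lt with rfl | ht
  · simp [revenueCurve]
  · exact mul_le_mul_of_nonneg_left (le_csSup (hμ.bddAbove_quantile ht) htw) ht.le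

theorem revenueCurve_le_mul (hμ : IsCarriedBy μ G) {t w : ℝ} (ht0 : 0 ≤ t) (ht1 : t ≤ 1)
    (htw : μ.real (Set.Ioi w) < t) : revenueCurve μ t ≤ t * w := by
  have := hμ.isProb
  refine mul_le_mul_of_nonneg_left (csSup_le ⟨0, ?_⟩ ?_) ht0
  · rwa [Set.mem_ofPred_eq, hμ.Ici_zero]
  · intro w' hw'
    by_contra! hlt
    exact absurd (hw'.trans (measureReal_mono (Set.Ici_subset_Ioi.2 hlt))) (not_le.2 htw)

theorem revenueCurve_le_of_bound (hμ : IsCarriedBy μ G) {B : ℝ} (hB : ∀ g ∈ G, g ≤ B)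
    {t : ℝ} (ht : t ∈ Set.Icc (0 : ℝ) 1) : revenueCurve μ t ≤ t * B := by
  rcases ht.1.eq_or_lt with rfl | h0
  · simp [revenueCurve]
  refine hμ.revenueCurve_le_mul ht.1 ht.2 ?_
  have hsub : Set.Ioi B ⊆ (G : Set ℝ)ᶜ := fun x hx hxG => absurd (hB x hxG) (not_le.2 hx)
  have : μ (Set.Ioi B) = 0 := measure_mono_null hsub hμ.compl_null
  rwa [measureReal_def, this, ENNReal.toReal_zero]

theorem bddBelow_majorants (μ : Measure ℝ) {q : ℝ} (hq : q ∈ Set.Icc (0 : ℝ) 1) :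
    BddBelow {y : ℝ | ∃ g : ℝ → ℝ, ConcaveOn ℝ (Set.Icc 0 1) g ∧
      (∀ t ∈ Set.Icc (0 : ℝ) 1, revenueCurve μ t ≤ g t) ∧ y = g q} := by
  refine ⟨revenueCurve μ q, ?_⟩
  rintro _ ⟨g, -, hg, rfl⟩
  exact hg q hq

theorem exists_majorant (hμ : IsCarriedBy μ G) (q : ℝ) :
    {y : ℝ | ∃ g : ℝ → ℝ, ConcaveOn ℝ (Set.Icc 0 1) g ∧
      (∀ t ∈ Set.Icc (0 : ℝ) 1, revenueCurve μ t ≤ g t) ∧ y = g q}.Nonempty := by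
  obtain ⟨B, hB0, hB⟩ := hμ.exists_bound
  refine ⟨_, fun t => t * B, ?_, fun t ht => hμ.revenueCurve_le_of_bound hB ht, rfl⟩
  exact ⟨convex_Icc 0 1, fun x _ y _ a b _ _ _ => by simp only [smul_eq_mul]; linarith⟩

theorem revenueCurve_le_ironed (hμ : IsCarriedBy μ G) {q : ℝ} (hq : q ∈ Set.Icc (0 : ℝ) 1) :
    revenueCurve μ q ≤ ironedRevenueCurve μ q := by
  refine le_csInf (hμ.exists_majorant q) ?_
  rintro _ ⟨g, -, hg, rfl⟩
  exact hg q hq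

theorem ironed_le_of_affine {a b q : ℝ}
    (h : ∀ t ∈ Set.Icc (0 : ℝ) 1, revenueCurve μ t ≤ a + b * t) (hq : q ∈ Set.Icc (0 : ℝ) 1) :
    ironedRevenueCurve μ q ≤ a + b * q := by
  refine csInf_le (bddBelow_majorants μ hq) ⟨fun t => a + b * t, ⟨convex_Icc 0 1, ?_⟩, h, rfl⟩
  intro x _ y _ s t _ _ hst
  simp only [smul_eq_mul]
  have : s * (a + b * x) + t * (a + b * y) = a * (s + t) + b * (s * x + t * y) := by ring
  rw [this, hst, mul_one]

theorem concaveOn_ironed (hμ : IsCarriedBy μ G) :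
    ConcaveOn ℝ (Set.Icc 0 1) (ironedRevenueCurve μ) := by
  refine ⟨convex_Icc 0 1, fun x hx y hy a b ha hb hab => ?_⟩
  refine le_csInf (hμ.exists_majorant _) ?_
  rintro _ ⟨g, hgc, hg, rfl⟩
  refine le_trans ?_ (hgc.2 hx hy ha hb hab)
  simp only [smul_eq_mul]
  gcongr
  · exact csInf_le (bddBelow_majorants μ hx) ⟨g, hgc, hg, rfl⟩
  · exact csInf_le (bddBelow_majorants μ hy) ⟨g, hgc, hg, rfl⟩

theorem ironed_zero (hμ : IsCarriedBy μ G) : ironedRevenueCurve μ 0 = 0 := by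
  obtain ⟨B, -, hB⟩ := hμ.exists_bound
  have h0 : (0 : ℝ) ∈ Set.Icc (0 : ℝ) 1 := by simp
  apply le_antisymm
  · have := ironed_le_of_affine (μ := μ) (a := 0) (b := B) (q := 0) (fun t ht => by
      have := hμ.revenueCurve_le_of_bound hB ht; linarith) h0
    simpa using this
  · have := hμ.revenueCurve_le_ironed h0
    simpa [revenueCurve] using this

theorem mem_Icc_measureReal (hμ : IsCarriedBy μ G) (s : Set ℝ) :
    μ.real s ∈ Set.Icc (0 : ℝ) 1 := by
  have := hμ.isProb
  exact ⟨measureReal_nonneg, measureReal_le_one⟩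

/-- This holds for all `w`: if `w` is not an atom, both sides vanish. -/
theorem virtualValue_mul (hμ : IsCarriedBy μ G) (w : ℝ) :
    ironedVirtualValue μ w * μ.real {w} =
      ironedRevenueCurve μ (μ.real (Set.Ici w)) - ironedRevenueCurve μ (μ.real (Set.Ioi w)) := by
  rcases (measureReal_nonneg (μ := μ) (s := {w})).eq_or_lt with h | h
  · rw [hμ.measureReal_Ici w, ← h]; simp
  · rw [ironedVirtualValue, div_mul_cancel₀ _ h.ne']

/-- To the left of the quantile interval of an atom `w`, the ironed revenue curve lies below its
chord over that interval. -/
theorem ironed_le_of_le_left (hμ : IsCarriedBy μ G) {w t : ℝ} (hw : 0 < μ.real {w}) (ht : 0 ≤ t)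
    (htw : t ≤ μ.real (Set.Ioi w)) :
    ironedRevenueCurve μ t ≤ ironedRevenueCurve μ (μ.real (Set.Ioi w)) -
      ironedVirtualValue μ w * (μ.real (Set.Ioi w) - t) := by
  rcases htw.eq_or_lt with rfl | hlt
  · simp
  have hI := hμ.measureReal_Ici w
  have := hμ.concaveOn_ironed.slope_anti_adjacent (x := t) (y := μ.real (Set.Ioi w))
    (z := μ.real (Set.Ici w)) ⟨ht, hlt.le.trans (hμ.mem_Icc_measureReal _).2⟩
    (hμ.mem_Icc_measureReal _) hlt (by linarith)
  rw [show μ.real (Set.Ici w) - μ.real (Set.Ioi w) = μ.real {w} by linarith,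
    le_div_iff₀ (by linarith)] at this
  rw [ironedVirtualValue]
  linarith

/-- To the right of the quantile interval of an atom `w`, the ironed revenue curve lies below its
chord over that interval. -/
theorem ironed_le_of_right_le (hμ : IsCarriedBy μ G) {w t : ℝ} (hw : 0 < μ.real {w}) (ht : t ≤ 1)
    (htw : μ.real (Set.Ici w) ≤ t) :
    ironedRevenueCurve μ t ≤ ironedRevenueCurve μ (μ.real (Set.Ici w)) +
      ironedVirtualValue μ w * (t - μ.real (Set.Ici w)) := by
  rcases htw.eq_or_lt with rfl | hlt
  · simp
  have hI := hμ.measureReal_Ici w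
  have := hμ.concaveOn_ironed.slope_anti_adjacent (x := μ.real (Set.Ioi w))
    (y := μ.real (Set.Ici w)) (z := t) (hμ.mem_Icc_measureReal _)
    ⟨(hμ.mem_Icc_measureReal _).1.trans hlt.le, ht⟩ (by linarith) hlt
  rw [show μ.real (Set.Ici w) - μ.real (Set.Ioi w) = μ.real {w} by linarith,
    div_le_iff₀ (by linarith)] at this
  rw [ironedVirtualValue]
  linarith

theorem virtualValue_mono (hμ : IsCarriedBy μ G) {w w' : ℝ} (hw : 0 < μ.real {w})
    (hw' : 0 < μ.real {w'}) (hlt : w' ≤ w) : ironedVirtualValue μ w' ≤ ironedVirtualValue μ w := by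
  have := hμ.isProb
  rcases hlt.eq_or_lt with rfl | hlt
  · exact le_rfl
  have h1 : μ.real (Set.Ici w) ≤ μ.real (Set.Ioi w') :=
    measureReal_mono (Set.Ici_subset_Ioi.2 hlt)
  have hI := hμ.measureReal_Ici w'
  have hI' := hμ.measureReal_Ici w
  have e1 := hμ.ironed_le_of_right_le hw (hμ.mem_Icc_measureReal (Set.Ici w')).2 (by linarith)
  have e2 := hμ.ironed_le_of_le_left hw' (hμ.mem_Icc_measureReal (Set.Ici w)).1 h1
  have e3 := hμ.virtualValue_mul w'
  rw [show μ.real {w'} = μ.real (Set.Ici w') - μ.real (Set.Ioi w') by linarith] at e3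
  refine le_of_mul_le_mul_right ?_
    (show 0 < μ.real (Set.Ici w') - μ.real (Set.Ici w) by linarith)
  linarith

/-- The virtual values of the upper part of the support add up to a point of the ironed revenue
curve. -/
theorem sum_virtualValue (hμ : IsCarriedBy μ G) (T : Finset ℝ)
    (hT : ∀ g ∈ G, ∀ a ∈ T, a ≤ g → g ∈ T) :
    ∑ g ∈ T, ironedVirtualValue μ g * μ.real {g} = ironedRevenueCurve μ (μ.real (T : Set ℝ)) := by
  have := hμ.isProb
  induction T using Finset.induction_on_min with
  | empty => simp [hμ.ironed_zero]
  | insert a s ha ih =>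
    have has : a ∉ s := fun h => lt_irrefl a (ha a h)
    have hs : ∀ g ∈ G, ∀ b ∈ s, b ≤ g → g ∈ s := fun g hg b hb hbg =>
      (Finset.mem_insert.1 (hT g hg b (Finset.mem_insert_of_mem hb) hbg)).resolve_left
        ((ha b hb).trans_le hbg).ne'
    have hae : ∀ᵐ x ∂μ, x ∈ G := mem_ae_iff.2 hμ.compl_null
    have e1 : μ.real (s : Set ℝ) = μ.real (Set.Ioi a) := by
      refine measureReal_congr ?_
      filter_upwards [hae] with x hx
      refine propext ⟨fun h => ha x h, fun h => ?_⟩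
      exact (Finset.mem_insert.1 (hT x hx a (Finset.mem_insert_self _ _)
        (le_of_lt h))).resolve_left (ne_of_gt h)
    have e2 : μ.real ((insert a s : Finset ℝ) : Set ℝ) = μ.real (Set.Ici a) := by
      rw [Finset.coe_insert, Set.insert_eq, Set.union_comm, measureReal_union
        (Set.disjoint_singleton_right.2 (by simpa using has)) (measurableSet_singleton a), e1,
        hμ.measureReal_Ici]
    rw [Finset.sum_insert has, ih hs, hμ.virtualValue_mul, e1, e2]
    ring

/-- Almost every value of a finitely supported distribution is an atom. -/
theorem ae_atom (hμ : IsCarriedBy μ G) :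
    ∀ᵐ x ∂μ, 0 < μ.real {x} := by
  have := hμ.isProb
  have h2 : μ (G.filter fun x => μ.real {x} = 0 : Finset ℝ) = 0 := by
    rw [← sum_measure_singleton]
    refine Finset.sum_eq_zero fun x hx => ?_
    have := (Finset.mem_filter.1 hx).2
    rwa [measureReal_eq_zero_iff] at this
  filter_upwards [mem_ae_iff.2 hμ.compl_null, measure_eq_zero_iff_ae_notMem.1 h2] with x hx hx2
  refine measureReal_nonneg.lt_of_ne' fun h => hx2 ?_
  simpa using ⟨hx, h⟩

/-- Where the ironed virtual value jumps, the revenue curve touches its concave majorant: otherwise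
the majorant could be cut off by a line of an intermediate slope. -/
theorem ironed_le_of_jump (hμ : IsCarriedBy μ G) {w : ℝ} (hw : 0 < μ.real {w})
    (hj : ∀ w' < w, 0 < μ.real {w'} → ironedVirtualValue μ w' < ironedVirtualValue μ w) :
    ironedRevenueCurve μ (μ.real (Set.Ici w)) ≤ μ.real (Set.Ici w) * w := by
  have := hμ.isProb
  set q := μ.real (Set.Ici w) with hq
  set p := μ.real (Set.Ioi w) with hp
  set φ := ironedVirtualValue μ w with hφ
  have hqI : q ∈ Set.Icc (0 : ℝ) 1 := hμ.mem_Icc_measureReal _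
  have hpI : p ∈ Set.Icc (0 : ℝ) 1 := hμ.mem_Icc_measureReal _
  have hqp : q = p + μ.real {w} := hμ.measureReal_Ici w
  have hmul := hμ.virtualValue_mul w
  rw [← hq, ← hp, ← hφ] at hmul
  by_contra! hc
  -- A line of slope `s < φ` through a point slightly below the curve at `q` is a majorant on `[0, q]`.
  have left : ∀ s η : ℝ, η ≤ ironedRevenueCurve μ q - q * w → η ≤ (φ - s) * μ.real {w} →
      s ≤ φ → ∀ t, 0 ≤ t → t ≤ q → revenueCurve μ t ≤ ironedRevenueCurve μ q - η + s * (t - q) := by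
    intro s η h1 h2 h3 t ht0 htq
    rcases le_or_gt t p with htp | htp
    · have e1 := hμ.ironed_le_of_le_left hw ht0 htp
      have e2 := hμ.revenueCurve_le_ironed ⟨ht0, htq.trans hqI.2⟩
      rw [← hp, ← hφ] at e1
      have e3 := mul_nonneg (sub_nonneg.2 h3) (sub_nonneg.2 htp)
      rw [hqp] at hmul ⊢
      linarith
    · refine (hμ.revenueCurve_le_mul ht0 (htq.trans hqI.2) htp).trans ?_
      have e1 : p * w ≤ ironedRevenueCurve μ p :=
        (hμ.mul_le_revenueCurve hpI.1 (by linarith)).trans (hμ.revenueCurve_le_ironed hpI)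
      have e2 : p * w ≤ ironedRevenueCurve μ q - η + s * (p - q) := by
        rw [show p - q = -μ.real {w} by linarith]
        linarith
      -- Both sides are affine on the quantile interval of `w`, so comparing its ends is enough.
      rcases le_or_gt w s with hws | hws
      · nlinarith
      · nlinarith
  -- By minimality, an affine majorant does not pass below the ironed curve at `q`.
  have key : ∀ a b : ℝ, (∀ t ∈ Set.Icc (0 : ℝ) 1, revenueCurve μ t ≤
      ironedRevenueCurve μ q - a + b * (t - q)) → a ≤ 0 := by
    intro a b h
    have := ironed_le_of_affine (μ := μ) (a := ironedRevenueCurve μ q - a - b * q) (b := b)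
      (fun t ht => (h t ht).trans_eq (by ring)) hqI
    linarith
  by_cases hne : ∃ w' < w, 0 < μ.real {w'}
  · -- The largest atom below `w`.
    obtain ⟨w', ⟨hw'w, hw'⟩, hmax⟩ : ∃ w', (w' < w ∧ 0 < μ.real {w'}) ∧
        ∀ v, v < w → 0 < μ.real {v} → v ≤ w' := by
      classical
      let A := G.filter fun v => v < w ∧ 0 < μ.real {v}
      have hA : A.Nonempty := by
        obtain ⟨v, hv, hv'⟩ := hne
        exact ⟨v, Finset.mem_filter.2 ⟨hμ.mem_of_pos hv', hv, hv'⟩⟩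
      refine ⟨A.max' hA, (Finset.mem_filter.1 (A.max'_mem hA)).2, fun v hv hv' =>
        A.le_max' v (Finset.mem_filter.2 ⟨hμ.mem_of_pos hv', hv, hv'⟩)⟩
    have hgap : μ.real (Set.Ioi w') = q := by
      rw [hq]
      refine measureReal_congr ?_
      filter_upwards [hμ.ae_atom] with x hx
      refine propext ⟨fun h => ?_, fun h => lt_of_lt_of_le hw'w h⟩
      by_contra hxw
      exact absurd (hmax x (not_le.1 hxw) hx) (not_le.2 h)
    set φ' := ironedVirtualValue μ w' with hφ'
    set q' := μ.real (Set.Ici w') with hq'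
    have hq'I : q' ∈ Set.Icc (0 : ℝ) 1 := hμ.mem_Icc_measureReal _
    have hqq' : q' = q + μ.real {w'} := by rw [hq', hμ.measureReal_Ici w', hgap]
    have hmul' := hμ.virtualValue_mul w'
    rw [hgap, ← hq', ← hφ'] at hmul'
    have hlt : φ' < φ := hj w' hw'w hw'
    obtain ⟨s, hs1, hs2⟩ := exists_between hlt
    obtain ⟨η, hη0, hη⟩ : ∃ η : ℝ, 0 < η ∧ η ≤ ironedRevenueCurve μ q - q * w ∧
        η ≤ (φ - s) * μ.real {w} ∧ η ≤ (s - φ') * μ.real {w'} := by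
      refine ⟨min (ironedRevenueCurve μ q - q * w) (min ((φ - s) * μ.real {w})
        ((s - φ') * μ.real {w'})), ?_, min_le_left _ _, (min_le_right _ _).trans (min_le_left _ _),
        (min_le_right _ _).trans (min_le_right _ _)⟩
      refine lt_min (by linarith) (lt_min (mul_pos (by linarith) hw) (mul_pos (by linarith) hw'))
    refine absurd (key η s fun t ht => ?_) (not_le.2 hη0)
    rcases le_or_gt t q with htq | htq
    · exact left s η hη.1 hη.2.1 hs2.le t ht.1 htq
    rcases le_or_gt t q' with htq' | htq'
    · refine (hμ.revenueCurve_le_mul ht.1 ht.2 (hgap.trans_lt htq)).trans ?_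
      have e1 : q' * w' ≤ ironedRevenueCurve μ q' :=
        (hμ.mul_le_revenueCurve hq'I.1 le_rfl).trans (hμ.revenueCurve_le_ironed hq'I)
      have e2 : q' * w' ≤ ironedRevenueCurve μ q - η + s * (q' - q) := by
        rw [show q' - q = μ.real {w'} by linarith]
        linarith
      have e3 : q * w' ≤ ironedRevenueCurve μ q - η := by nlinarith [hqI.1]
      rcases le_or_gt w' s with hws | hws
      · nlinarith
      · nlinarith
    · have e1 := hμ.ironed_le_of_right_le hw' ht.2 htq'.le
      have e2 := hμ.revenueCurve_le_ironed ht
      rw [← hq', ← hφ'] at e1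
      have e3 := mul_nonneg (sub_nonneg.2 hs1.le) (sub_nonneg.2 htq'.le)
      have e4 : s * (t - q) = s * (t - q') + s * μ.real {w'} := by rw [hqq']; ring
      linarith
  · push Not at hne
    have hq1 : q = 1 := by
      rw [hq, measureReal_def, (mem_ae_iff_prob_eq_one measurableSet_Ici).1, ENNReal.toReal_one]
      filter_upwards [hμ.ae_atom] with x hx
      exact not_lt.1 fun h => absurd hx (not_lt.2 (hne x h))
    obtain ⟨η, hη0, hη⟩ : ∃ η : ℝ, 0 < η ∧ η ≤ ironedRevenueCurve μ q - q * w ∧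
        η ≤ (φ - (φ - 1)) * μ.real {w} :=
      ⟨min (ironedRevenueCurve μ q - q * w) ((φ - (φ - 1)) * μ.real {w}),
        lt_min (by linarith) (mul_pos (by linarith) hw), min_le_left _ _, min_le_right _ _⟩
    refine absurd (key η (φ - 1) fun t ht => ?_) (not_le.2 hη0)
    exact left (φ - 1) η hη.1 hη.2 (by linarith) t ht.1 (ht.2.trans_eq hq1.symm)

end IsCarriedBy

/-! ### Reports, winners and payments in Myerson's auction -/

namespace IsCarriedBy

variable {μ : Measure ℝ} {G : Finset ℝ}

theorem reportVirtualValue_atom {a : ℝ} (ha : 0 < μ.real {a}) :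
    reportVirtualValue μ a = ironedVirtualValue μ a := by
  have : sSup {w : ℝ | w ≤ a ∧ 0 < μ.real {w}} = a :=
    IsGreatest.csSup_eq ⟨⟨le_rfl, ha⟩, fun w hw => hw.1⟩
  rw [reportVirtualValue, if_pos ⟨a, le_rfl, ha⟩, this]

/-- A report above the lowest atom is treated as the largest atom below it. -/
theorem exists_top_atom (hμ : IsCarriedBy μ G) {v : ℝ} (hv : ∃ w, w ≤ v ∧ 0 < μ.real {w}) :
    ∃ a ≤ v, 0 < μ.real {a} ∧ (∀ w ≤ v, 0 < μ.real {w} → w ≤ a) ∧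
      reportVirtualValue μ v = reportVirtualValue μ a := by
  classical
  let A := G.filter fun w => w ≤ v ∧ 0 < μ.real {w}
  have hA : A.Nonempty := by
    obtain ⟨w, hw, hw'⟩ := hv
    exact ⟨w, Finset.mem_filter.2 ⟨hμ.mem_of_pos hw', hw, hw'⟩⟩
  have h1 := (Finset.mem_filter.1 (A.max'_mem hA)).2
  have h2 : ∀ w ≤ v, 0 < μ.real {w} → w ≤ A.max' hA := fun w hw hw' =>
    A.le_max' w (Finset.mem_filter.2 ⟨hμ.mem_of_pos hw', hw, hw'⟩)
  refine ⟨A.max' hA, h1.1, h1.2, h2, ?_⟩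
  have : sSup {w : ℝ | w ≤ v ∧ 0 < μ.real {w}} = A.max' hA :=
    IsGreatest.csSup_eq ⟨h1, fun w hw => h2 w hw.1 hw.2⟩
  rw [reportVirtualValue_atom h1.2, reportVirtualValue, if_pos hv, this]

theorem exists_atom_of_nonneg (hμ : IsCarriedBy μ G) {v : ℝ} (hv : 0 ≤ reportVirtualValue μ v) :
    ∃ a ≤ v, 0 < μ.real {a} ∧ reportVirtualValue μ a = reportVirtualValue μ v := by
  by_cases h : ∃ w, w ≤ v ∧ 0 < μ.real {w}
  · obtain ⟨a, h1, h2, -, h3⟩ := hμ.exists_top_atom h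
    exact ⟨a, h1, h2, h3.symm⟩
  · rw [reportVirtualValue, if_neg h] at hv
    exact absurd hv (by simp)

theorem monotone_reportVirtualValue (hμ : IsCarriedBy μ G) : Monotone (reportVirtualValue μ) := by
  intro v v' hvv
  by_cases h : ∃ w, w ≤ v ∧ 0 < μ.real {w}
  · obtain ⟨a, h1, h2, -, h3⟩ := hμ.exists_top_atom h
    obtain ⟨w, hw, hw'⟩ := h
    obtain ⟨b, -, h5, h6, h7⟩ := hμ.exists_top_atom ⟨w, hw.trans hvv, hw'⟩
    rw [h3, h7, reportVirtualValue_atom h2, reportVirtualValue_atom h5, EReal.coe_le_coe_iff]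
    exact hμ.virtualValue_mono h5 h2 (h6 a (h1.trans hvv) h2)
  · rw [reportVirtualValue, if_neg h]
    exact bot_le

end IsCarriedBy

theorem MyersonWins.unique {n : ℕ} {E : Fin n → Measure ℝ} {v : Fin n → ℝ} {i j : Fin n}
    (hi : MyersonWins E v i) (hj : MyersonWins E v j) : i = j := by
  rcases hi.2 j with h | ⟨h, hij⟩
  · rcases hj.2 i with h' | ⟨h', -⟩
    · exact absurd h h'.asymm
    · exact absurd h' h.ne'
  · rcases hj.2 i with h' | ⟨-, hji⟩
    · exact absurd h h'.ne'
    · exact le_antisymm hij hji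

theorem MyersonWins.mono {n : ℕ} {E : Fin n → Measure ℝ} {v v' : Fin n → ℝ} {i : Fin n}
    (h : MyersonWins E v i) (hj : ∀ j ≠ i, v' j = v j)
    (hi : reportVirtualValue (E i) (v i) ≤ reportVirtualValue (E i) (v' i)) :
    MyersonWins E v' i := by
  refine ⟨h.1.trans hi, fun j => ?_⟩
  by_cases hji : j = i
  · subst hji
    exact Or.inr ⟨rfl, le_rfl⟩
  rw [hj j hji]
  rcases h.2 j with h' | ⟨h', hij⟩
  · exact Or.inl (h'.trans_le hi)
  · rw [h']
    rcases hi.eq_or_lt with h2 | h2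
    · exact Or.inr ⟨h2, hij⟩
    · exact Or.inl h2

theorem MyersonWins.update_mono {n : ℕ} {E : Fin n → Measure ℝ} {v : Fin n → ℝ} {i : Fin n}
    {s t : ℝ} (h : MyersonWins E (Function.update v i s) i)
    (hst : reportVirtualValue (E i) s ≤ reportVirtualValue (E i) t) :
    MyersonWins E (Function.update v i t) i := by
  refine h.mono (fun j hj => by simp [hj]) ?_
  simpa using hst

theorem bddBelow_winning {n : ℕ} (E : Fin n → Measure ℝ) (v : Fin n → ℝ) (i : Fin n) :
    BddBelow {t : ℝ | 0 ≤ t ∧ MyersonWins E (Function.update v i t) i} :=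
  ⟨0, fun _ ht => ht.1⟩

theorem myersonAuction_p_nonneg {n : ℕ} (E : Fin n → Measure ℝ) (v : Fin n → ℝ) (i : Fin n) :
    0 ≤ (myersonAuction E).p v i := by
  simp only [myersonAuction]
  split_ifs
  · exact Real.sInf_nonneg fun t ht => ht.1
  · exact le_rfl

theorem myersonAuction_p_le {n : ℕ} (E : Fin n → Measure ℝ) {v : Fin n → ℝ} (hv : 0 ≤ v)
    {i : Fin n} (hi : MyersonWins E v i) : (myersonAuction E).p v i ≤ v i := by
  simp only [myersonAuction]
  rw [if_pos hi]
  exact csInf_le (bddBelow_winning E v i) ⟨hv i, by rwa [Function.update_eq_self]⟩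

theorem myersonAuction_p_of_not {n : ℕ} {E : Fin n → Measure ℝ} {v : Fin n → ℝ} {i : Fin n}
    (hi : ¬ MyersonWins E v i) : (myersonAuction E).p v i = 0 := by
  simp only [myersonAuction]
  rw [if_neg hi]

theorem myersonAuction_sum_p_nonneg {n : ℕ} (E : Fin n → Measure ℝ) (v : Fin n → ℝ) :
    0 ≤ ∑ i, (myersonAuction E).p v i :=
  Finset.sum_nonneg fun i _ => myersonAuction_p_nonneg E v i

/-- The revenue is at most the winner's report. -/
theorem myersonAuction_sum_p_le {n : ℕ} (E : Fin n → Measure ℝ) {v : Fin n → ℝ} (hv : 0 ≤ v)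
    {h : ℝ} (h0 : 0 ≤ h) (hh : ∀ i, v i ≤ h) : ∑ i, (myersonAuction E).p v i ≤ h := by
  by_cases hw : ∃ i, MyersonWins E v i
  · obtain ⟨i, hi⟩ := hw
    rw [Finset.sum_eq_single i (fun j _ hji => myersonAuction_p_of_not fun hj => hji (hj.unique hi))
      (by simp)]
    exact (myersonAuction_p_le E hv hi).trans (hh i)
  · push Not at hw
    rw [Finset.sum_eq_zero fun i _ => myersonAuction_p_of_not (hw i)]
    exact h0

/-! ### Myerson's auction on rounded reports -/

/-- Myerson's auction for `E`, run on the reports rounded down to powers of `1 - ε`. -/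
noncomputable def roundedMyerson (ε : ℝ) {n : ℕ} (E : Fin n → Measure ℝ) : Mechanism n where
  x v := (myersonAuction E).x fun i => roundDown ε (v i)
  p v := (myersonAuction E).p fun i => roundDown ε (v i)

theorem roundDown_update {ε : ℝ} {n : ℕ} (v : Fin n → ℝ) (i : Fin n) (b : ℝ) :
    (fun j => roundDown ε (Function.update v i b j)) =
      Function.update (fun j => roundDown ε (v j)) i (roundDown ε b) := by
  ext j
  by_cases h : j = i
  · subst h; simp
  · simp [h]

/-- What makes the auction truthful for a bidder with distribution `μ`: the virtual value is
monotone in the report, and changes only at values that are not affected by rounding. -/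
structure IsStaircase (ε : ℝ) (μ : Measure ℝ) : Prop where
  mono : Monotone (reportVirtualValue μ)
  step : ∀ t, 0 ≤ reportVirtualValue μ t →
    ∃ a ≤ t, roundDown ε a = a ∧ reportVirtualValue μ a = reportVirtualValue μ t

theorem IsCarriedBy.isStaircase {ε : ℝ} {μ : Measure ℝ} {G : Finset ℝ} (hμ : IsCarriedBy μ G)
    (hG : ∀ g ∈ G, roundDown ε g = g) : IsStaircase ε μ where
  mono := hμ.monotone_reportVirtualValue
  step t ht := by
    obtain ⟨a, hat, ha, h⟩ := hμ.exists_atom_of_nonneg ht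
    exact ⟨a, hat, hG a (hμ.mem_of_pos ha), h⟩

theorem isStaircase_zero (ε : ℝ) : IsStaircase ε 0 := by
  have h : ∀ v, reportVirtualValue 0 v = ⊥ := fun v => by simp [reportVirtualValue]
  exact ⟨fun v w _ => by rw [h, h], fun t ht => by rw [h] at ht; exact absurd ht (by simp)⟩

theorem roundedMyerson_isAdmissible {ε : ℝ} (h0 : 0 < ε) (h1 : ε < 1) {n : ℕ}
    {E : Fin n → Measure ℝ} (hE : ∀ i, IsStaircase ε (E i)) :
    (roundedMyerson ε E).IsAdmissible where
  measurable_x := measurable_comp_roundDown h0 h1 (myersonAuction E).x measurable_id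
  measurable_p := measurable_comp_roundDown h0 h1 (myersonAuction E).p measurable_id
  feasible v _ := by
    set u : Fin n → ℝ := fun i => roundDown ε (v i)
    change (∀ i, 0 ≤ (myersonAuction E).x u i) ∧ ∑ i, (myersonAuction E).x u i ≤ 1
    simp only [myersonAuction]
    refine ⟨fun i => by split_ifs <;> norm_num, ?_⟩
    by_cases hw : ∃ i, MyersonWins E u i
    · obtain ⟨i, hi⟩ := hw
      rw [Finset.sum_eq_single i (fun j _ hji => if_neg fun hj => hji (hj.unique hi)) (by simp)]
      exact (if_pos hi).le
    · push Not at hw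
      rw [Finset.sum_eq_zero fun i _ => if_neg (hw i)]
      exact zero_le_one
  dsic v hv i b _ := by
    simp only [roundedMyerson, roundDown_update]
    set u : Fin n → ℝ := fun i => roundDown ε (v i)
    have hu : 0 ≤ u := fun i => roundDown_nonneg h1 _
    have hbdd := bddBelow_winning E u i
    simp only [myersonAuction, Function.update_idem]
    by_cases hw : MyersonWins E u i
    · have hle : sInf {t : ℝ | 0 ≤ t ∧ MyersonWins E (Function.update u i t) i} ≤ v i :=
        (csInf_le hbdd ⟨hu i, by rwa [Function.update_eq_self]⟩).trans (roundDown_le h0 h1 (hv i))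
      simp only [if_pos hw]
      split_ifs <;> linarith
    · simp only [if_neg hw]
      split_ifs with hb
      · -- A report that wins is at least an atom above the rounded value, hence above the value.
        have hge : v i ≤ sInf {t : ℝ | 0 ≤ t ∧ MyersonWins E (Function.update u i t) i} := by
          refine le_csInf ⟨_, roundDown_nonneg h1 b, hb⟩ fun t ht => ?_
          by_contra! hlt
          have h3 : 0 ≤ reportVirtualValue (E i) t := by simpa using ht.2.1
          obtain ⟨a, hat, hra, hva⟩ := (hE i).step t h3
          refine hw ?_
          have h4 : a ≤ u i := by
            rw [← hra]
            exact monotone_roundDown h1 (hat.trans hlt.le)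
          have := ht.2.update_mono (hva.symm.le.trans ((hE i).mono h4))
          rwa [Function.update_eq_self] at this
        linarith
      · linarith
  ir v hv i := by
    simp only [roundedMyerson]
    set u : Fin n → ℝ := fun i => roundDown ε (v i)
    have hu : 0 ≤ u := fun i => roundDown_nonneg h1 _
    by_cases hw : MyersonWins E u i
    · have h2 := (myersonAuction_p_le E hu hw).trans (roundDown_le h0 h1 (hv i))
      have h3 : (myersonAuction E).x u i = 1 := by simp only [myersonAuction]; rw [if_pos hw]
      rw [h3]
      linarith
    · rw [myersonAuction_p_of_not hw]
      have h3 : (myersonAuction E).x u i = 0 := by simp only [myersonAuction]; rw [if_neg hw]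
      rw [h3]
      simp

theorem isProbabilityMeasure_empiricalMeasure {m : ℕ} (hm : 0 < m) (s : Fin m → ℝ) :
    IsProbabilityMeasure (empiricalMeasure s) := by
  constructor
  simp only [empiricalMeasure, Measure.smul_apply, Measure.finsetSum_apply, measure_univ,
    Finset.sum_const, Finset.card_univ, Fintype.card_fin, smul_eq_mul, nsmul_eq_mul, mul_one]
  exact ENNReal.inv_mul_cancel (by exact_mod_cast hm.ne') (by simp)

theorem isCarriedBy_empiricalMeasure {m : ℕ} (hm : 0 < m) {s : Fin m → ℝ} {G : Finset ℝ}
    (hG : ∀ g ∈ G, 0 ≤ g) (hs : ∀ j, s j ∈ G) : IsCarriedBy (empiricalMeasure s) G where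
  isProb := isProbabilityMeasure_empiricalMeasure hm s
  nonneg := hG
  compl_null := by
    simp [empiricalMeasure, Measure.finsetSum_apply, hs]

theorem empiricalMyerson_isAdmissible {n m : ℕ} {ε : ℝ} (h0 : 0 < ε) (h1 : ε < 1)
    (S : Fin m → Fin n → ℝ) : (empiricalMyerson ε S).IsAdmissible := by
  classical
  refine roundedMyerson_isAdmissible h0 h1 fun i => ?_
  rcases Nat.eq_zero_or_pos m with rfl | hm
  · have : (empiricalMeasure fun j => roundDown ε (S j i)) = 0 := by simp [empiricalMeasure]
    rw [this]
    exact isStaircase_zero ε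
  · refine (isCarriedBy_empiricalMeasure hm (G := Finset.univ.image fun j => roundDown ε (S j i))
      ?_ fun j => Finset.mem_image_of_mem _ (Finset.mem_univ j)).isStaircase ?_
    · intro g hg
      obtain ⟨j, -, rfl⟩ := Finset.mem_image.1 hg
      exact roundDown_nonneg h1 _
    · intro g hg
      obtain ⟨j, -, rfl⟩ := Finset.mem_image.1 hg
      exact roundDown_roundDown h0 h1 _

/-! ### The revenue from one bidder is at most her ironed virtual surplus -/

namespace IsCarriedBy

variable {μ : Measure ℝ} {G : Finset ℝ}

/-- Off the atoms, the virtual value is a quotient by zero. -/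
theorem virtualValue_eq_zero (hμ : IsCarriedBy μ G) {w : ℝ} (hw : w ∉ G) :
    ironedVirtualValue μ w = 0 := by
  have : μ.real {w} = 0 := by
    by_contra h
    exact hw (hμ.mem_of_pos (measureReal_nonneg.lt_of_ne' h))
  rw [ironedVirtualValue, this, div_zero]

theorem virtualValue_eq_sum (hμ : IsCarriedBy μ G) :
    ironedVirtualValue μ =
      fun w => ∑ g ∈ G, ({g} : Set ℝ).indicator (fun _ => ironedVirtualValue μ g) w := by
  ext w
  by_cases hw : w ∈ G
  · rw [Finset.sum_eq_single w (fun g _ hg => Set.indicator_of_notMem (by simpa using hg.symm) _)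
      (fun h => absurd hw h)]
    simp
  · rw [hμ.virtualValue_eq_zero hw, Finset.sum_eq_zero]
    intro g hg
    exact Set.indicator_of_notMem (by rintro rfl; exact hw hg) _

theorem measurable_virtualValue (hμ : IsCarriedBy μ G) : Measurable (ironedVirtualValue μ) := by
  rw [hμ.virtualValue_eq_sum]
  exact Finset.measurable_fun_sum G fun g _ =>
    measurable_const.indicator (measurableSet_singleton g)

theorem exists_virtualValue_bound (hμ : IsCarriedBy μ G) :
    ∃ K : ℝ, 0 ≤ K ∧ ∀ w, |ironedVirtualValue μ w| ≤ K := by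
  refine ⟨∑ g ∈ G, |ironedVirtualValue μ g|, Finset.sum_nonneg fun g _ => abs_nonneg _, fun w => ?_⟩
  by_cases hw : w ∈ G
  · exact Finset.single_le_sum (f := fun g => |ironedVirtualValue μ g|) (fun g _ => abs_nonneg _) hw
  · rw [hμ.virtualValue_eq_zero hw, abs_zero]
    exact Finset.sum_nonneg fun g _ => abs_nonneg _

end IsCarriedBy

section OneBidder

variable {D : Measure ℝ} {r : ℝ → ℝ} {G : Finset ℝ}

theorem setIntegral_comp_eq_sum [IsProbabilityMeasure D] (hr : Measurable r)
    (hμ : IsCarriedBy (D.map r) G) (F : ℝ → ℝ) (U : Set ℝ) :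
    ∫ w in U, F (r w) ∂D = ∑ g ∈ G, F g * D.real (U ∩ r ⁻¹' {g}) := by
  have hae : ∀ᵐ w ∂D, r w ∈ G := by
    have : ∀ᵐ y ∂(D.map r), y ∈ G := mem_ae_iff.2 hμ.compl_null
    exact ae_of_ae_map hr.aemeasurable this
  have h1 : ∀ᵐ w ∂(D.restrict U), F (r w) =
      ∑ g ∈ G, (r ⁻¹' {g}).indicator (fun _ => F g) w := by
    filter_upwards [ae_restrict_of_ae hae] with w hw
    rw [Finset.sum_eq_single (r w)
      (fun g _ hg => Set.indicator_of_notMem (by simpa using hg.symm) _) (fun h => absurd hw h)]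
    simp
  rw [integral_congr_ae h1, integral_finsetSum]
  · refine Finset.sum_congr rfl fun g _ => ?_
    have hm : MeasurableSet (r ⁻¹' {g}) := hr (measurableSet_singleton g)
    rw [integral_indicator hm, Measure.restrict_restrict hm, setIntegral_const, smul_eq_mul,
      mul_comm, Set.inter_comm]
  · intro g _
    exact (integrable_const _).indicator (hr (measurableSet_singleton g))

/-- The revenue from a posted price, sold to exactly the types in an upper set `U` of values above
the price, is at most the ironed virtual surplus of `U`. On the quantile interval of the lowest
rounded value in `U`, the ironed revenue curve lies above its chord, which lies above the revenue
at that value. -/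
theorem mul_measureReal_le_setIntegral [IsProbabilityMeasure D] (hr : Measurable r)
    (hrm : Monotone r) (hμ : IsCarriedBy (D.map r) G) {U : Set ℝ}
    (hup : ∀ w ∈ U, ∀ w', w ≤ w' → w' ∈ U) {τ : ℝ} (hτ : ∀ w ∈ U, τ ≤ r w) :
    τ * D.real U ≤ ∫ w in U, ironedVirtualValue (D.map r) (r w) ∂D := by
  classical
  set μ := D.map r with hμd
  have hprob := hμ.isProb
  have hsing : ∀ g, μ.real {g} = D.real (r ⁻¹' {g}) := fun g => by
    rw [hμd, map_measureReal_apply hr (measurableSet_singleton g)]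
  set a : ℝ → ℝ := fun g => D.real (U ∩ r ⁻¹' {g}) with ha
  have hDU : D.real U = ∑ g ∈ G, a g := by
    have := setIntegral_comp_eq_sum hr hμ (fun _ => 1) U
    simpa using this
  rw [setIntegral_comp_eq_sum hr hμ _ U]
  have ha0 : ∀ g, 0 ≤ a g := fun g => measureReal_nonneg
  by_cases hne : ∃ g ∈ G, 0 < a g
  swap
  · push Not at hne
    have h0 : ∀ g ∈ G, a g = 0 := fun g hg => (hne g hg).antisymm (ha0 g)
    rw [hDU, Finset.sum_eq_zero h0, Finset.sum_eq_zero fun g hg => by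
      change _ * a g = 0; rw [h0 g hg, mul_zero]]
    simp
  obtain ⟨g₀, ⟨hg₀, hag₀⟩, hmin⟩ : ∃ g₀, (g₀ ∈ G ∧ 0 < a g₀) ∧ ∀ g ∈ G, 0 < a g → g₀ ≤ g := by
    let A := G.filter fun g => 0 < a g
    have hA : A.Nonempty := by
      obtain ⟨g, hg, hg'⟩ := hne
      exact ⟨g, Finset.mem_filter.2 ⟨hg, hg'⟩⟩
    exact ⟨A.min' hA, Finset.mem_filter.1 (A.min'_mem hA), fun g hg hg' =>
      A.min'_le g (Finset.mem_filter.2 ⟨hg, hg'⟩)⟩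
  obtain ⟨w₀, hw₀U, hw₀⟩ : (U ∩ r ⁻¹' {g₀}).Nonempty := by
    by_contra h
    rw [Set.not_nonempty_iff_eq_empty] at h
    simp [ha, h] at hag₀
  have hw₀ : r w₀ = g₀ := hw₀
  have habove : ∀ g, g₀ < g → a g = μ.real {g} := by
    intro g hg
    rw [hsing]
    change D.real (U ∩ r ⁻¹' {g}) = _
    congr 1
    refine Set.inter_eq_right.2 fun w hw => hup w₀ hw₀U w ?_
    by_contra! hlt
    have := hrm hlt.le
    rw [hw₀, show r w = g from hw] at this
    exact absurd hg (not_lt.2 this)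
  set T := G.filter fun g => g₀ < g with hT
  have hsplit : ∀ F : ℝ → ℝ, ∑ g ∈ G, F g * a g = ∑ g ∈ T, F g * μ.real {g} + F g₀ * a g₀ := by
    intro F
    rw [← Finset.sum_filter_add_sum_filter_not G (fun g => g₀ < g)]
    congr 1
    · exact Finset.sum_congr rfl fun g hg => by rw [habove g (Finset.mem_filter.1 hg).2]
    · refine Finset.sum_eq_single g₀ (fun g hg hne => ?_) (fun h => ?_)
      · obtain ⟨hgG, hgl⟩ := Finset.mem_filter.1 hg
        have : a g = 0 := by
          by_contra h
          exact hne (le_antisymm (not_lt.1 hgl) (hmin g hgG ((ha0 g).lt_of_ne' h)))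
        rw [this, mul_zero]
      · exact absurd (Finset.mem_filter.2 ⟨hg₀, lt_irrefl _⟩) h
  have hTm : μ.real (T : Set ℝ) = μ.real (Set.Ioi g₀) := by
    refine measureReal_congr ?_
    filter_upwards [mem_ae_iff.2 hμ.compl_null] with x hx
    have hx : x ∈ G := hx
    refine propext ⟨fun h => (Finset.mem_filter.1 h).2, fun h => Finset.mem_filter.2 ⟨hx, h⟩⟩
  have e1 := hsplit (ironedVirtualValue μ)
  rw [hμ.sum_virtualValue T (fun g hg b hb hbg => Finset.mem_filter.2
    ⟨hg, (Finset.mem_filter.1 hb).2.trans_le hbg⟩), hTm] at e1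
  have e2 := hsplit (fun _ => 1)
  simp only [one_mul] at e2
  rw [← hDU, sum_measureReal_singleton, hTm] at e2
  change _ ≤ ∑ g ∈ G, ironedVirtualValue μ g * a g
  rw [e1]
  set p := μ.real (Set.Ioi g₀) with hp
  set q := μ.real (Set.Ici g₀) with hq
  have hqp : q = p + μ.real {g₀} := hμ.measureReal_Ici g₀
  have hpI : p ∈ Set.Icc (0 : ℝ) 1 := hμ.mem_Icc_measureReal _
  have hqI : q ∈ Set.Icc (0 : ℝ) 1 := hμ.mem_Icc_measureReal _
  have hm0 : 0 ≤ μ.real {g₀} := measureReal_nonneg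
  have hle : a g₀ ≤ μ.real {g₀} := by
    rw [hsing]
    exact measureReal_mono Set.inter_subset_right
  have b1 : p * g₀ ≤ ironedRevenueCurve μ p :=
    (hμ.mul_le_revenueCurve hpI.1 (by linarith)).trans (hμ.revenueCurve_le_ironed hpI)
  have b2 : q * g₀ ≤ ironedRevenueCurve μ q :=
    (hμ.mul_le_revenueCurve hqI.1 le_rfl).trans (hμ.revenueCurve_le_ironed hqI)
  have b3 := hμ.virtualValue_mul g₀
  rw [← hp, ← hq] at b3
  have b4 : τ * D.real U ≤ g₀ * (p + a g₀) := by
    rw [e2]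
    exact mul_le_mul_of_nonneg_right (hw₀ ▸ hτ w₀ hw₀U) (by linarith [hpI.1])
  rcases le_or_gt g₀ (ironedVirtualValue μ g₀) with hc | hc
  · have := mul_le_mul_of_nonneg_right hc hag₀.le
    linarith
  · have := mul_nonneg (sub_nonneg.2 hc.le) (sub_nonneg.2 hle)
    rw [hqp] at b2 b3
    linarith

/-- A function whose increments are of second order is decreasing. -/
theorem le_of_increment_le {F X : ℝ → ℝ} {w : ℝ} (hw : 0 ≤ w)
    (h : ∀ a b, 0 ≤ a → a ≤ b → b ≤ w → F b - F a ≤ (b - a) * (X b - X a)) : F w ≤ F 0 := by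
  have key : ∀ N : ℕ, 0 < N → F w - F 0 ≤ w / N * (X w - X 0) := by
    intro N hN
    have hN' : (0 : ℝ) < N := by exact_mod_cast hN
    have hind : ∀ k : ℕ, k ≤ N → F (k * (w / N)) - F 0 ≤ w / N * (X (k * (w / N)) - X 0) := by
      intro k
      induction k with
      | zero => intro _; simp
      | succ k ih =>
        intro hk
        have h1 := ih (by omega)
        have h2 := h (k * (w / N)) ((k + 1 : ℕ) * (w / N)) (by positivity)
          (by push_cast; nlinarith [div_nonneg hw hN'.le]) (by
            have : ((k + 1 : ℕ) : ℝ) ≤ N := by exact_mod_cast hk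
            calc ((k + 1 : ℕ) : ℝ) * (w / N) ≤ N * (w / N) := by gcongr
              _ = w := by field_simp)
        rw [show ((k + 1 : ℕ) : ℝ) * (w / N) - k * (w / N) = w / N by push_cast; ring] at h2
        linarith
    have := hind N le_rfl
    rwa [show (N : ℝ) * (w / N) = w by field_simp] at this
  have hlim : Filter.Tendsto (fun N : ℕ => w / (N : ℝ) * (X w - X 0)) Filter.atTop (nhds 0) := by
    simpa using (tendsto_const_div_atTop_nhds_zero_nat w).mul_const (X w - X 0)
  have := ge_of_tendsto hlim (Filter.eventually_atTop.2 ⟨1, fun N hN => key N hN⟩)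
  linarith

/-- The lowest value at which the winning probability `x` is at least `y`, truncated at `H`; in
particular it is `H` for levels `y` that are never reached. -/
noncomputable def allocationThreshold (x : ℝ → ℝ) (H y : ℝ) : ℝ :=
  sInf ({t : ℝ | 0 ≤ t ∧ y ≤ x t} ∪ {H})

section Threshold

variable {x p : ℝ → ℝ} {H : ℝ}

theorem bddBelow_threshold (hH : 0 ≤ H) (y : ℝ) :
    BddBelow ({t : ℝ | 0 ≤ t ∧ y ≤ x t} ∪ {H}) := by
  refine ⟨0, ?_⟩
  rintro t (ht | rfl)
  · exact ht.1
  · exact hH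

theorem monotone_allocationThreshold (hH : 0 ≤ H) : Monotone (allocationThreshold x H) :=
  fun _ _ hy => csInf_le_csInf (bddBelow_threshold hH _) ⟨H, Or.inr rfl⟩
    (Set.union_subset_union_left _ fun _ ht => ⟨ht.1, hy.trans ht.2⟩)

theorem allocationThreshold_nonneg (hH : 0 ≤ H) (y : ℝ) : 0 ≤ allocationThreshold x H y := by
  refine le_csInf ⟨H, Or.inr rfl⟩ ?_
  rintro t (ht | rfl)
  · exact ht.1
  · exact hH

theorem allocationThreshold_le_bound (hH : 0 ≤ H) (y : ℝ) : allocationThreshold x H y ≤ H :=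
  csInf_le (bddBelow_threshold hH y) (Or.inr rfl)

theorem allocationThreshold_le (hH : 0 ≤ H) {t y : ℝ} (ht : 0 ≤ t) (hy : y ≤ x t) :
    allocationThreshold x H y ≤ t :=
  csInf_le (bddBelow_threshold hH y) (Or.inl ⟨ht, hy⟩)

/-- The winning probability of an incentive compatible mechanism is monotone. -/
theorem monotone_of_incentiveCompatible
    (hic : ∀ a b, 0 ≤ a → 0 ≤ b → a * x b - p b ≤ a * x a - p a) :
    ∀ a b, 0 ≤ a → a ≤ b → x a ≤ x b := by
  intro a b ha hab
  rcases hab.eq_or_lt with rfl | hlt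
  · exact le_rfl
  have h1 := hic a b ha (ha.trans hab)
  have h2 := hic b a (ha.trans hab) ha
  by_contra! hc
  nlinarith

/-- Payments are at most those of the posted price `allocationThreshold x H y` with a uniformly
random level `y`. -/
theorem payment_le_integral (hic : ∀ a b, 0 ≤ a → 0 ≤ b → a * x b - p b ≤ a * x a - p a)
    (hx0 : 0 ≤ x 0) (hp0 : p 0 ≤ 0) {w : ℝ} (hw : 0 ≤ w) (hwH : w ≤ H) :
    p w ≤ ∫ y in (0 : ℝ)..x w, allocationThreshold x H y := by
  have hH : 0 ≤ H := hw.trans hwH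
  have hmono := monotone_of_incentiveCompatible hic
  have hint : ∀ a b, IntervalIntegrable (allocationThreshold x H) volume a b := fun a b =>
    (monotone_allocationThreshold hH).intervalIntegrable
  have key := le_of_increment_le (F := fun w => p w - ∫ y in (0 : ℝ)..x w, allocationThreshold x H y)
    (X := x) hw ?_
  · have h0 : 0 ≤ ∫ y in (0 : ℝ)..x 0, allocationThreshold x H y :=
      intervalIntegral.integral_nonneg hx0 fun y _ => allocationThreshold_nonneg hH y
    linarith
  intro a b ha hab hbw
  have hxab := hmono a b ha hab
  have h1 : p b - p a ≤ b * (x b - x a) := by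
    have := hic b a (ha.trans hab) ha
    linarith
  have h2 : a * (x b - x a) ≤ ∫ y in x a..x b, allocationThreshold x H y := by
    have : ∫ _ in x a..x b, a ≤ ∫ y in x a..x b, allocationThreshold x H y := by
      refine intervalIntegral.integral_mono_on_of_le_Ioo hxab (by simp) (hint _ _) fun y hy => ?_
      refine le_csInf ⟨H, Or.inr rfl⟩ ?_
      rintro t (ht | rfl)
      · by_contra! hlt
        exact absurd (hy.1.trans_le (ht.2.trans (hmono t a ht.1 hlt.le))) (lt_irrefl _)
      · exact hab.trans (hbw.trans hwH)
    rwa [intervalIntegral.integral_const, smul_eq_mul, mul_comm] at this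
  have h3 := intervalIntegral.integral_interval_sub_left (hint 0 (x b)) (hint 0 (x a))
  linarith

/-- The expected payment of one bidder is at most her expected ironed virtual surplus. -/
theorem mul_integral_payment_le [IsProbabilityMeasure D] {c : ℝ} (hc : 0 ≤ c) (hH : 0 ≤ H)
    (hD : ∀ᵐ w ∂D, w ∈ Set.Icc 0 H) (hr : Measurable r) (hrm : Monotone r)
    (hcr : ∀ w, 0 ≤ w → c * w ≤ r w) (hμ : IsCarriedBy (D.map r) G) (hx : Measurable x)
    (hx0 : ∀ w, 0 ≤ w → 0 ≤ x w) (hx1 : ∀ w, 0 ≤ w → x w ≤ 1)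
    (hic : ∀ a b, 0 ≤ a → 0 ≤ b → a * x b - p b ≤ a * x a - p a) (hp0 : p 0 ≤ 0)
    (hp : Integrable p D) :
    c * ∫ w, p w ∂D ≤ ∫ w, ironedVirtualValue (D.map r) (r w) * x w ∂D := by
  set φ := ironedVirtualValue (D.map r) with hφ
  set ν : Measure ℝ := volume.restrict (Set.Ioc 0 1) with hν
  set τ := allocationThreshold x H with hτ
  have hτm : Measurable τ := (monotone_allocationThreshold hH).measurable
  set W : Set (ℝ × ℝ) := {z | 0 ≤ z.1 ∧ z.2 ≤ x z.1} with hW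
  have hWm : MeasurableSet W :=
    (measurableSet_le measurable_const measurable_fst).inter
      (measurableSet_le measurable_snd (hx.comp measurable_fst))
  obtain ⟨K, -, hK⟩ := hμ.exists_virtualValue_bound
  have hφm : Measurable φ := hμ.measurable_virtualValue
  have hA : Integrable (W.indicator fun z : ℝ × ℝ => c * τ z.2) (D.prod ν) := by
    refine Integrable.indicator ?_ hWm
    refine Integrable.of_bound ((hτm.comp measurable_snd).const_mul c).aestronglyMeasurable (c * H)
      (ae_of_all _ fun z => ?_)
    rw [Real.norm_eq_abs, abs_of_nonneg (mul_nonneg hc (allocationThreshold_nonneg hH _))]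
    exact mul_le_mul_of_nonneg_left (allocationThreshold_le_bound hH _) hc
  have hB : Integrable (W.indicator fun z : ℝ × ℝ => φ (r z.1)) (D.prod ν) := by
    refine Integrable.indicator ?_ hWm
    exact Integrable.of_bound ((hφm.comp hr).comp measurable_fst).aestronglyMeasurable K
      (ae_of_all _ fun z => hK _)
  -- For a fixed value, integrate over the levels.
  have slice : ∀ w, 0 ≤ w → ∀ f : ℝ → ℝ, ∫ y, W.indicator (fun z : ℝ × ℝ => f z.2) (w, y) ∂ν =
      ∫ y in (0 : ℝ)..x w, f y := by
    intro w hw f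
    rw [intervalIntegral.integral_of_le (hx0 w hw)]
    have h1 : (fun y => W.indicator (fun z : ℝ × ℝ => f z.2) (w, y)) =
        (Set.Iic (x w)).indicator f := by
      ext y
      simp only [Set.indicator, hW, Set.mem_ofPred_eq, Set.mem_Iic, hw, true_and]
    rw [h1, integral_indicator measurableSet_Iic, hν, Measure.restrict_restrict measurableSet_Iic]
    congr 2
    ext y
    simp only [Set.mem_inter_iff, Set.mem_Iic, Set.mem_Ioc]
    constructor
    · rintro ⟨h1, h2, -⟩; exact ⟨h2, h1⟩
    · rintro ⟨h1, h2⟩; exact ⟨h2, h1, h2.trans (hx1 w hw)⟩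
  have hsl2 : ∀ w, 0 ≤ w → ∫ y, W.indicator (fun z : ℝ × ℝ => φ (r z.1)) (w, y) ∂ν =
      φ (r w) * x w := by
    intro w hw
    have := slice w hw fun _ => φ (r w)
    rw [intervalIntegral.integral_const, smul_eq_mul, sub_zero, mul_comm] at this
    rw [← this]
    rfl
  have hleft : c * ∫ w, p w ∂D ≤ ∫ w, ∫ y, W.indicator (fun z : ℝ × ℝ => c * τ z.2) (w, y) ∂ν ∂D := by
    rw [← integral_const_mul]
    refine integral_mono_ae (hp.const_mul c) hA.integral_prod_left ?_
    filter_upwards [hD] with w hw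
    rw [slice w hw.1 fun y => c * τ y, intervalIntegral.integral_const_mul]
    exact mul_le_mul_of_nonneg_left
      (payment_le_integral hic (hx0 0 le_rfl) hp0 hw.1 hw.2) hc
  have hright : ∫ w, ∫ y, W.indicator (fun z : ℝ × ℝ => φ (r z.1)) (w, y) ∂ν ∂D =
      ∫ w, φ (r w) * x w ∂D := by
    refine integral_congr_ae ?_
    filter_upwards [hD] with w hw
    exact hsl2 w hw.1
  rw [← hright]
  refine hleft.trans ?_
  rw [integral_integral_swap (f := fun w y => W.indicator (fun z : ℝ × ℝ => c * τ z.2) (w, y)) hA,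
    integral_integral_swap (f := fun w y => W.indicator (fun z : ℝ × ℝ => φ (r z.1)) (w, y)) hB]
  refine integral_mono hA.integral_prod_right hB.integral_prod_right fun y => ?_
  -- For a fixed level, the mechanism is a posted price.
  set U : Set ℝ := {w | 0 ≤ w ∧ y ≤ x w} with hU
  have hUm : MeasurableSet U :=
    (measurableSet_le measurable_const measurable_id).inter (measurableSet_le measurable_const hx)
  have h1 : (fun w => W.indicator (fun z : ℝ × ℝ => c * τ z.2) (w, y)) =
      U.indicator fun _ => c * τ y := rfl
  have h2 : (fun w => W.indicator (fun z : ℝ × ℝ => φ (r z.1)) (w, y)) =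
      U.indicator fun w => φ (r w) := rfl
  simp only [h1, h2]
  rw [integral_indicator hUm, integral_indicator hUm, setIntegral_const, smul_eq_mul, mul_comm]
  refine mul_measureReal_le_setIntegral hr hrm hμ (U := U) (fun w hw w' hww => ⟨hw.1.trans hww,
    hw.2.trans (monotone_of_incentiveCompatible hic w w' hw.1 hww)⟩) fun w hw => ?_
  exact (mul_le_mul_of_nonneg_left (allocationThreshold_le hH hw.1 hw.2) hc).trans (hcr w hw.1)

end Threshold

end OneBidder

/-! ### Myerson's auction is optimal -/

/-- Resampling one coordinate of a product measure does not change it. -/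
theorem measurePreserving_update {n : ℕ} (D : Fin n → Measure ℝ)
    [∀ i, IsProbabilityMeasure (D i)] (i : Fin n) :
    MeasurePreserving (fun z : (Fin n → ℝ) × ℝ => Function.update z.1 i z.2)
      ((Measure.pi D).prod (D i)) (Measure.pi D) := by
  have hm : Measurable fun z : (Fin n → ℝ) × ℝ => Function.update z.1 i z.2 := by
    refine measurable_pi_lambda _ fun j => ?_
    by_cases h : j = i
    · subst h; simpa using measurable_snd
    · simpa [h, Function.comp_def] using
        (measurable_pi_apply (X := fun _ : Fin n => ℝ) j).comp measurable_fst
  refine ⟨hm, (Measure.pi_eq fun s hs => ?_).symm⟩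
  rw [Measure.map_apply hm (MeasurableSet.univ_pi hs)]
  have : (fun z : (Fin n → ℝ) × ℝ => Function.update z.1 i z.2) ⁻¹' Set.univ.pi s =
      (Set.univ.pi (Function.update s i Set.univ)) ×ˢ s i := by
    ext z
    simp only [Set.mem_preimage, Set.mem_univ_pi, Set.mem_prod]
    constructor
    · intro h
      refine ⟨fun j => ?_, by simpa using h i⟩
      by_cases hj : j = i
      · subst hj; simp
      · simpa [hj] using h j
    · rintro ⟨h1, h2⟩ j
      by_cases hj : j = i
      · subst hj; simpa using h2
      · simpa [hj] using h1 j
  rw [this, Measure.prod_prod, Measure.pi_pi, ← Finset.mul_prod_erase _ _ (Finset.mem_univ i),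
    ← Finset.mul_prod_erase _ (fun j => D j (s j)) (Finset.mem_univ i)]
  simp only [Function.update_self, measure_univ, one_mul]
  rw [mul_comm]
  congr 1
  refine Finset.prod_congr rfl fun j hj => ?_
  rw [Function.update_of_ne (Finset.ne_of_mem_erase hj)]

theorem integrable_of_compl_finset_null {α : Type*} [MeasurableSpace α] [MeasurableSingletonClass α]
    {ν : Measure α} [IsFiniteMeasure ν] {T : Set α} (hT : T.Finite) (h : ν Tᶜ = 0) (F : α → ℝ) :
    Integrable F ν := by
  have h1 : IntegrableOn F T ν := by
    rw [← Set.biUnion_of_singleton T, integrableOn_finite_biUnion hT]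
    exact fun a _ => integrableOn_singleton
  rwa [IntegrableOn, Measure.restrict_eq_self_of_ae_mem (mem_ae_iff.2 h)] at h1

section Auction

variable {n : ℕ}

theorem pi_compl_null {μ : Fin n → Measure ℝ} {G : Fin n → Finset ℝ}
    (hμ : ∀ i, IsCarriedBy (μ i) (G i)) :
    Measure.pi μ (Set.univ.pi fun i => (G i : Set ℝ))ᶜ = 0 := by
  have := fun i => (hμ i).isProb
  rw [← mem_ae_iff]
  have : ∀ᵐ v ∂Measure.pi μ, ∀ i, v i ∈ G i := ae_all_iff.2 fun i =>
    (Measure.tendsto_eval_ae_ae (i := i)).eventually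
      (show ∀ᵐ y ∂μ i, y ∈ G i from mem_ae_iff.2 (hμ i).compl_null)
  filter_upwards [this] with v hv i _ using hv i

theorem integrable_pi_of_isCarriedBy {μ : Fin n → Measure ℝ} {G : Fin n → Finset ℝ}
    (hμ : ∀ i, IsCarriedBy (μ i) (G i)) (F : (Fin n → ℝ) → ℝ) : Integrable F (Measure.pi μ) := by
  have := fun i => (hμ i).isProb
  exact integrable_of_compl_finset_null (Set.Finite.pi fun i => (G i).finite_toSet)
    (pi_compl_null hμ) F

theorem IsCarriedBy.setIntegral_Ici {μ : Measure ℝ} {G : Finset ℝ} (hμ : IsCarriedBy μ G) (a : ℝ) :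
    ∫ t in Set.Ici a, ironedVirtualValue μ t ∂μ = ironedRevenueCurve μ (μ.real (Set.Ici a)) := by
  have := hμ.isProb
  have h1 := setIntegral_comp_eq_sum (D := μ) (r := id) measurable_id (by rwa [Measure.map_id])
    (ironedVirtualValue μ) (Set.Ici a)
  simp only [id, Set.preimage_id] at h1
  have h2 : μ.real (G.filter fun g => a ≤ g : Finset ℝ) = μ.real (Set.Ici a) := by
    refine measureReal_congr ?_
    filter_upwards [mem_ae_iff.2 hμ.compl_null] with x hx
    have hx : x ∈ G := hx
    exact propext ⟨fun h => (Finset.mem_filter.1 h).2, fun h => Finset.mem_filter.2 ⟨hx, h⟩⟩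
  rw [h1, ← h2, ← hμ.sum_virtualValue _ fun g hg b hb hbg => Finset.mem_filter.2
    ⟨hg, (Finset.mem_filter.1 hb).2.trans hbg⟩, Finset.sum_filter]
  refine Finset.sum_congr rfl fun g _ => ?_
  split_ifs with h
  · rw [Set.inter_eq_right.2 (Set.singleton_subset_iff.2 (Set.mem_Ici.2 h))]
  · rw [(Set.disjoint_singleton_right.2 (mt Set.mem_Ici.1 h)).inter_eq]
    simp

/-- Against fixed reports of the others, the winning threshold of a bidder lies where her ironed
virtual value jumps, so that the threshold price earns her ironed virtual surplus. -/
theorem setIntegral_virtualValue_le {μ : Fin n → Measure ℝ} {i : Fin n} {G : Finset ℝ}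
    (hμ : IsCarriedBy (μ i) G) (u : Fin n → ℝ) :
    ∫ t, ironedVirtualValue (μ i) t * (myersonAuction μ).x (Function.update u i t) i ∂(μ i) ≤
      ∫ t, (myersonAuction μ).p (Function.update u i t) i ∂(μ i) := by
  classical
  have hprob := hμ.isProb
  set A := G.filter fun t => 0 < (μ i).real {t} ∧ MyersonWins μ (Function.update u i t) i with hA
  have hAmem : ∀ t, 0 < (μ i).real {t} → MyersonWins μ (Function.update u i t) i → t ∈ A :=
    fun t h1 h2 => Finset.mem_filter.2 ⟨hμ.mem_of_pos h1, h1, h2⟩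
  rcases A.eq_empty_or_nonempty with hemp | hne
  · have h0 : ∀ᵐ t ∂(μ i), ironedVirtualValue (μ i) t *
        (myersonAuction μ).x (Function.update u i t) i = 0 := by
      filter_upwards [hμ.ae_atom] with t ht
      simp only [myersonAuction]
      rw [if_neg, mul_zero]
      intro hw
      have := hAmem t ht hw
      rw [hemp] at this
      exact absurd this (Finset.notMem_empty t)
    rw [integral_congr_ae h0, integral_zero]
    exact integral_nonneg fun t => myersonAuction_p_nonneg _ _ _
  set a := A.min' hne with ha
  obtain ⟨haG, ha1, ha2⟩ := Finset.mem_filter.1 (A.min'_mem hne)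
  rw [← ha] at haG ha1 ha2
  have hmin : ∀ t, 0 < (μ i).real {t} → MyersonWins μ (Function.update u i t) i → a ≤ t :=
    fun t h1 h2 => A.min'_le t (hAmem t h1 h2)
  have hwin : ∀ t, a ≤ t → MyersonWins μ (Function.update u i t) i := fun t ht =>
    ha2.update_mono (hμ.monotone_reportVirtualValue ht)
  have hthr : a ≤ sInf {t : ℝ | 0 ≤ t ∧ MyersonWins μ (Function.update u i t) i} := by
    refine le_csInf ⟨a, hμ.nonneg a haG, ha2⟩ fun t ht => ?_
    have h3 : 0 ≤ reportVirtualValue (μ i) t := by simpa using ht.2.1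
    obtain ⟨b, hbt, hb, hbv⟩ := hμ.exists_atom_of_nonneg h3
    exact (hmin b hb (ht.2.update_mono hbv.symm.le)).trans hbt
  have hl : ∀ᵐ t ∂(μ i), ironedVirtualValue (μ i) t *
      (myersonAuction μ).x (Function.update u i t) i =
        (Set.Ici a).indicator (ironedVirtualValue (μ i)) t := by
    filter_upwards [hμ.ae_atom] with t ht
    simp only [myersonAuction]
    by_cases hat : a ≤ t
    · rw [if_pos (hwin t hat), Set.indicator_of_mem (show t ∈ Set.Ici a from hat), mul_one]
    · rw [if_neg fun h => hat (hmin t ht h), Set.indicator_of_notMem (show t ∉ Set.Ici a from hat),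
        mul_zero]
  have hr : ∀ t, (Set.Ici a).indicator (fun _ => a) t ≤
      (myersonAuction μ).p (Function.update u i t) i := by
    intro t
    by_cases hat : a ≤ t
    · rw [Set.indicator_of_mem (show t ∈ Set.Ici a from hat)]
      simp only [myersonAuction, Function.update_idem]
      rwa [if_pos (hwin t hat)]
    · rw [Set.indicator_of_notMem (show t ∉ Set.Ici a from hat)]
      exact myersonAuction_p_nonneg _ _ _
  have hfin : ∀ F : ℝ → ℝ, Integrable F (μ i) :=
    integrable_of_compl_finset_null G.finite_toSet hμ.compl_null
  calc _ = ∫ t in Set.Ici a, ironedVirtualValue (μ i) t ∂(μ i) := by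
        rw [integral_congr_ae hl, integral_indicator measurableSet_Ici]
    _ ≤ (μ i).real (Set.Ici a) * a := by
        rw [hμ.setIntegral_Ici]
        refine hμ.ironed_le_of_jump ha1 fun w' hw' hw'1 => ?_
        by_contra! hc
        refine absurd (hmin w' hw'1 (ha2.update_mono ?_)) (not_le.2 hw')
        rwa [IsCarriedBy.reportVirtualValue_atom ha1, IsCarriedBy.reportVirtualValue_atom hw'1,
          EReal.coe_le_coe_iff]
    _ = ∫ t, (Set.Ici a).indicator (fun _ => a) t ∂(μ i) := by
        rw [integral_indicator measurableSet_Ici, setIntegral_const, smul_eq_mul]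
    _ ≤ _ := integral_mono (hfin _) (hfin _) hr

theorem integral_update {D : Fin n → Measure ℝ} [∀ i, IsProbabilityMeasure (D i)] (i : Fin n)
    {F : (Fin n → ℝ) → ℝ} (hF : Integrable F (Measure.pi D)) :
    Integrable (fun z : (Fin n → ℝ) × ℝ => F (Function.update z.1 i z.2))
      ((Measure.pi D).prod (D i)) ∧
    ∫ v, F v ∂Measure.pi D = ∫ v, ∫ t, F (Function.update v i t) ∂(D i) ∂Measure.pi D := by
  have hmp := measurePreserving_update D i
  have h1 : Integrable (fun z : (Fin n → ℝ) × ℝ => F (Function.update z.1 i z.2))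
      ((Measure.pi D).prod (D i)) := hmp.integrable_comp_of_integrable hF
  refine ⟨h1, ?_⟩
  rw [integral_integral (f := fun v t => F (Function.update v i t)) h1]
  conv_lhs => rw [← hmp.map_eq]
  rw [integral_map hmp.measurable.aemeasurable]
  rw [hmp.map_eq]
  exact hF.aestronglyMeasurable

/-- The revenue of Myerson's auction is at least its ironed virtual surplus. -/
theorem virtualSurplus_le_rev {μ : Fin n → Measure ℝ} {G : Fin n → Finset ℝ}
    (hμ : ∀ i, IsCarriedBy (μ i) (G i)) :
    ∫ u, ∑ i, ironedVirtualValue (μ i) (u i) * (myersonAuction μ).x u i ∂Measure.pi μ ≤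
      (myersonAuction μ).rev μ := by
  have := fun i => (hμ i).isProb
  have hint := integrable_pi_of_isCarriedBy hμ
  rw [Mechanism.rev, integral_finsetSum _ fun i _ => hint _, integral_finsetSum _ fun i _ => hint _]
  refine Finset.sum_le_sum fun i _ => ?_
  obtain ⟨h1, h2⟩ := integral_update i
    (hint fun u => ironedVirtualValue (μ i) (u i) * (myersonAuction μ).x u i)
  obtain ⟨h3, h4⟩ := integral_update i (hint fun u => (myersonAuction μ).p u i)
  rw [h2, h4]
  refine integral_mono h1.integral_prod_left h3.integral_prod_left fun u => ?_
  simpa using setIntegral_virtualValue_le (hμ i) u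

variable {D : Fin n → Measure ℝ} {M : Mechanism n} {H : ℝ}

theorem Mechanism.IsAdmissible.p_le (hM : M.IsAdmissible) {v : Fin n → ℝ} (hv : 0 ≤ v) (i : Fin n) :
    M.p v i ≤ v i := by
  have h1 := hM.ir v hv i
  have h2 : M.x v i ≤ 1 :=
    (Finset.single_le_sum (f := fun i => M.x v i) (fun j _ => (hM.feasible v hv).1 j)
      (Finset.mem_univ i)).trans (hM.feasible v hv).2
  have h3 := mul_le_of_le_one_right (hv i) h2
  linarith

theorem Mechanism.IsAdmissible.sum_p_le (hM : M.IsAdmissible) {v : Fin n → ℝ} (hv : 0 ≤ v)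
    (hH : 0 ≤ H) (hvH : ∀ i, v i ≤ H) : ∑ i, M.p v i ≤ H := by
  calc ∑ i, M.p v i ≤ ∑ i, H * M.x v i := Finset.sum_le_sum fun i _ => by
        have := hM.ir v hv i
        have := mul_le_mul_of_nonneg_right (hvH i) ((hM.feasible v hv).1 i)
        linarith
    _ ≤ H := by
        rw [← Finset.mul_sum]
        exact mul_le_of_le_one_right hH (hM.feasible v hv).2

theorem ae_forall_mem_Icc [∀ i, IsProbabilityMeasure (D i)] {a : ℝ}
    (hD : ∀ i, ∀ᵐ w ∂(D i), w ∈ Set.Icc a H) :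
    ∀ᵐ v ∂Measure.pi D, ∀ i, v i ∈ Set.Icc a H :=
  ae_all_iff.2 fun i => (Measure.tendsto_eval_ae_ae (i := i)).eventually (hD i)

/-- Integrability of the revenue gives integrability of every single payment, as payments are
bounded above. -/
theorem Mechanism.IsAdmissible.integrable_p [∀ i, IsProbabilityMeasure (D i)]
    (hD : ∀ i, ∀ᵐ w ∂(D i), w ∈ Set.Icc 0 H) (hH : 0 ≤ H) (hM : M.IsAdmissible)
    (hint : Integrable (fun v => ∑ i, M.p v i) (Measure.pi D)) (i : Fin n) :
    Integrable (fun v => M.p v i) (Measure.pi D) := by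
  refine Integrable.mono' (hint.norm.add (integrable_const (n * H)))
    ((measurable_pi_apply i).comp hM.measurable_p).aestronglyMeasurable ?_
  filter_upwards [ae_forall_mem_Icc hD] with v hv
  have hv0 : 0 ≤ v := fun j => (hv j).1
  have hle : ∀ j, M.p v j ≤ H := fun j => (hM.p_le hv0 j).trans (hv j).2
  have h1 : ∑ j ∈ Finset.univ.erase i, M.p v j ≤ (n - 1 : ℝ) * H := by
    have hn : 1 ≤ n := Fin.pos i
    calc _ ≤ ∑ j ∈ Finset.univ.erase i, H := Finset.sum_le_sum fun j _ => hle j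
      _ = (n - 1 : ℝ) * H := by
        rw [Finset.sum_const, Finset.card_erase_of_mem (Finset.mem_univ i), Finset.card_univ,
          Fintype.card_fin, nsmul_eq_mul, Nat.cast_sub hn, Nat.cast_one]
  have h2 := Finset.add_sum_erase Finset.univ (fun j => M.p v j) (Finset.mem_univ i)
  have hn : (1 : ℝ) ≤ n := by exact_mod_cast Fin.pos i
  have hnH : H ≤ n * H := le_mul_of_one_le_left hH hn
  simp only [Pi.add_apply, Real.norm_eq_abs]
  rw [abs_le]
  have h3 := neg_abs_le (∑ j, M.p v j)
  have h4 := abs_nonneg (∑ j, M.p v j)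
  constructor
  · linarith
  · linarith [hle i]

variable {r : ℝ → ℝ} {G : Fin n → Finset ℝ} {c : ℝ}

/-- The revenue of an admissible mechanism is, up to the loss of rounding, at most the ironed
virtual surplus of its allocation. -/
theorem Mechanism.IsAdmissible.mul_rev_le_surplus [∀ i, IsProbabilityMeasure (D i)]
    (hD : ∀ i, ∀ᵐ w ∂(D i), w ∈ Set.Icc 0 H) (hH : 0 ≤ H) (hc : 0 ≤ c) (hr : Measurable r)
    (hrm : Monotone r) (hcr : ∀ w, 0 ≤ w → c * w ≤ r w)
    (hμ : ∀ i, IsCarriedBy ((D i).map r) (G i)) (hM : M.IsAdmissible)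
    (hint : Integrable (fun v => ∑ i, M.p v i) (Measure.pi D)) :
    Integrable (fun v => ∑ i, ironedVirtualValue ((D i).map r) (r (v i)) * M.x v i)
      (Measure.pi D) ∧
    c * M.rev D ≤
      ∫ v, ∑ i, ironedVirtualValue ((D i).map r) (r (v i)) * M.x v i ∂Measure.pi D := by
  have hp := hM.integrable_p hD hH hint
  have hxm : ∀ i, Measurable fun v => M.x v i := fun i =>
    (measurable_pi_apply i).comp hM.measurable_x
  have hx0 : ∀ v : Fin n → ℝ, 0 ≤ v → ∀ i, 0 ≤ M.x v i := fun v hv i => (hM.feasible v hv).1 i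
  have hx1 : ∀ v : Fin n → ℝ, 0 ≤ v → ∀ i, M.x v i ≤ 1 := fun v hv i =>
    (Finset.single_le_sum (f := fun i => M.x v i) (fun j _ => (hM.feasible v hv).1 j)
      (Finset.mem_univ i)).trans (hM.feasible v hv).2
  have hs : ∀ i, Integrable (fun v => ironedVirtualValue ((D i).map r) (r (v i)) * M.x v i)
      (Measure.pi D) := by
    intro i
    obtain ⟨K, hK0, hK⟩ := (hμ i).exists_virtualValue_bound
    refine Integrable.of_bound ((((hμ i).measurable_virtualValue.comp hr).comp
      (measurable_pi_apply i)).mul (hxm i)).aestronglyMeasurable K ?_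
    filter_upwards [ae_forall_mem_Icc hD] with v hv
    have hv0 : 0 ≤ v := fun j => (hv j).1
    simp only [norm_mul, Real.norm_eq_abs]
    rw [abs_of_nonneg (hx0 v hv0 i)]
    exact (mul_le_mul (hK _) (hx1 v hv0 i) (hx0 v hv0 i) hK0).trans_eq (mul_one K)
  refine ⟨integrable_finsetSum _ fun i _ => hs i, ?_⟩
  rw [Mechanism.rev, integral_finsetSum _ fun i _ => hp i, integral_finsetSum _ fun i _ => hs i,
    Finset.mul_sum]
  refine Finset.sum_le_sum fun i _ => ?_
  obtain ⟨h1, h2⟩ := integral_update i (hp i)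
  obtain ⟨h3, h4⟩ := integral_update i (hs i)
  rw [h2, h4, ← integral_const_mul]
  refine integral_mono_ae (h1.integral_prod_left.const_mul c) h3.integral_prod_left ?_
  filter_upwards [ae_forall_mem_Icc hD, h1.prod_right_ae] with v hv hpv
  have hv0 : ∀ t, 0 ≤ t → 0 ≤ Function.update v i t := fun t ht j => by
    by_cases hj : j = i
    · subst hj; simpa using ht
    · simpa [hj] using (hv j).1
  have hum : Measurable fun t => Function.update v i t := measurable_update v
  simp only [Function.update_self]
  refine mul_integral_payment_le hc hH (hD i) hr hrm hcr (hμ i) ((hxm i).comp hum)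
    (fun w hw => hx0 _ (hv0 w hw) i) (fun w hw => hx1 _ (hv0 w hw) i) ?_ ?_ hpv
  · intro a b ha hb
    simpa using hM.dsic _ (hv0 a ha) i b hb
  · simpa using hM.ir _ (hv0 0 le_rfl) i

/-- Myerson's auction maximizes the ironed virtual surplus for every profile of atoms. -/
theorem sum_virtualValue_mul_le {μ : Fin n → Measure ℝ} {u x : Fin n → ℝ}
    (hu : ∀ i, 0 < (μ i).real {u i}) (hx : ∀ i, 0 ≤ x i) (hx1 : ∑ i, x i ≤ 1) :
    ∑ i, ironedVirtualValue (μ i) (u i) * x i ≤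
      ∑ i, ironedVirtualValue (μ i) (u i) * (myersonAuction μ).x u i := by
  have hval : ∀ i, reportVirtualValue (μ i) (u i) = ironedVirtualValue (μ i) (u i) := fun i =>
    IsCarriedBy.reportVirtualValue_atom (hu i)
  set φ : Fin n → ℝ := fun i => ironedVirtualValue (μ i) (u i) with hφ
  have hwins : ∀ i, MyersonWins μ u i ↔ 0 ≤ φ i ∧ ∀ j, φ j < φ i ∨ (φ j = φ i ∧ i ≤ j) := by
    intro i
    simp only [MyersonWins, hval, EReal.coe_lt_coe_iff, EReal.coe_eq_coe_iff, EReal.coe_nonneg]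
    rfl
  by_cases hw : ∃ i, MyersonWins μ u i
  · obtain ⟨i, hi⟩ := hw
    have hR : ∑ j, φ j * (myersonAuction μ).x u j = φ i := by
      rw [Finset.sum_eq_single i]
      · simp only [myersonAuction]; rw [if_pos hi, mul_one]
      · intro j _ hji
        simp only [myersonAuction]
        rw [if_neg fun hj => hji (hj.unique hi), mul_zero]
      · simp
    rw [hR]
    have h1 := (hwins i).1 hi
    calc ∑ j, φ j * x j ≤ ∑ j, φ i * x j := Finset.sum_le_sum fun j _ =>
          mul_le_mul_of_nonneg_right ((h1.2 j).elim le_of_lt fun h => h.1.le) (hx j)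
      _ ≤ φ i := by
          rw [← Finset.mul_sum]
          exact mul_le_of_le_one_right h1.1 hx1
  · have hneg : ∀ i, φ i < 0 := by
      by_contra! hc
      -- The smallest index among the bidders with the highest virtual value wins.
      obtain ⟨i₀, hi₀⟩ := hc
      obtain ⟨m, -, hm⟩ := Finset.exists_max_image Finset.univ φ ⟨i₀, Finset.mem_univ _⟩
      have hne : (Finset.univ.filter fun i => φ i = φ m).Nonempty := ⟨m, by simp⟩
      refine hw ⟨_, (hwins ((Finset.univ.filter fun i => φ i = φ m).min' hne)).2 ?_⟩
      have hk := (Finset.mem_filter.1 (Finset.min'_mem _ hne)).2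
      rw [hk]
      refine ⟨hi₀.trans (hm i₀ (Finset.mem_univ _)), fun j => ?_⟩
      rcases (hm j (Finset.mem_univ _)).lt_or_eq with h | h
      · exact Or.inl h
      · exact Or.inr ⟨h, Finset.min'_le _ _ (by simpa using h)⟩
    push Not at hw
    have hR : ∑ j, φ j * (myersonAuction μ).x u j = 0 := by
      refine Finset.sum_eq_zero fun j _ => ?_
      simp only [myersonAuction]
      rw [if_neg (hw j), mul_zero]
    rw [hR]
    exact Finset.sum_nonpos fun j _ => mul_nonpos_of_nonpos_of_nonneg (hneg j).le (hx j)

/-- If values are rounded by `r` with a loss of at most a factor `c`, then Myerson's auction for the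
rounded distribution earns at least a `c`-fraction of the revenue of any mechanism. With `r = id`
and `c = 1` this is the optimality of Myerson's auction. -/
theorem Mechanism.IsAdmissible.mul_rev_le_myerson [∀ i, IsProbabilityMeasure (D i)]
    (hD : ∀ i, ∀ᵐ w ∂(D i), w ∈ Set.Icc 0 H) (hH : 0 ≤ H) (hc : 0 ≤ c) (hr : Measurable r)
    (hrm : Monotone r) (hcr : ∀ w, 0 ≤ w → c * w ≤ r w)
    (hμ : ∀ i, IsCarriedBy ((D i).map r) (G i)) (hM : M.IsAdmissible)
    (hint : Integrable (fun v => ∑ i, M.p v i) (Measure.pi D)) :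
    c * M.rev D ≤ (myersonAuction fun i => (D i).map r).rev fun i => (D i).map r := by
  set μ : Fin n → Measure ℝ := fun i => (D i).map r with hμd
  obtain ⟨hi, hle⟩ := hM.mul_rev_le_surplus hD hH hc hr hrm hcr hμ hint
  have := fun i => (hμ i).isProb
  have hR : Measurable fun (v : Fin n → ℝ) i => r (v i) :=
    measurable_pi_lambda _ fun i => hr.comp (measurable_pi_apply i)
  have hmap : Measure.pi μ = (Measure.pi D).map fun v i => r (v i) :=
    (Measure.pi_map_pi fun i => hr.aemeasurable).symm
  set F : (Fin n → ℝ) → ℝ := fun u =>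
    ∑ i, ironedVirtualValue (μ i) (u i) * (myersonAuction μ).x u i with hF
  have hFi : Integrable F (Measure.pi μ) := integrable_pi_of_isCarriedBy hμ F
  refine hle.trans (le_trans ?_ (virtualSurplus_le_rev hμ))
  rw [hmap] at hFi ⊢
  rw [integral_map hR.aemeasurable hFi.aestronglyMeasurable]
  refine integral_mono_ae hi (hFi.comp_measurable hR) ?_
  have hatom : ∀ᵐ v ∂Measure.pi D, ∀ i, 0 < (μ i).real {r (v i)} := ae_all_iff.2 fun i =>
    (Measure.tendsto_eval_ae_ae (i := i)).eventually
      (ae_of_ae_map hr.aemeasurable (hμ i).ae_atom)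
  filter_upwards [ae_forall_mem_Icc hD, hatom] with v hv hat
  have hv0 : 0 ≤ v := fun j => (hv j).1
  exact sum_virtualValue_mul_le hat (hM.feasible v hv0).1 (hM.feasible v hv0).2

end Auction

/-! ### Concentration of expectations under the product of the empirical distributions -/

/-- The expectation of `f` under the product of the coordinatewise empirical distributions of the
sample `S`. -/
noncomputable def productMean {n m : ℕ} (f : (Fin n → ℝ) → ℝ) (S : Fin m → Fin n → ℝ) : ℝ :=
  ((m : ℝ) ^ n)⁻¹ * ∑ j : Fin n → Fin m, f fun i => S (j i) i

theorem integral_pi_empiricalMeasure {n m : ℕ} (hm : 0 < m) (f : (Fin n → ℝ) → ℝ)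
    (S : Fin m → Fin n → ℝ) :
    ∫ u, f u ∂Measure.pi (fun i => empiricalMeasure fun j => S j i) = productMean f S := by
  classical
  have hE : ∀ i, IsProbabilityMeasure (empiricalMeasure fun j => S j i) := fun i =>
    isProbabilityMeasure_empiricalMeasure hm _
  have hpi : Measure.pi (fun i => empiricalMeasure fun j => S j i) =
      ((m : ENNReal)⁻¹ ^ n) • ∑ j : Fin n → Fin m, Measure.dirac fun i => S (j i) i := by
    refine (Measure.pi_eq fun s hs => ?_)
    simp only [empiricalMeasure, Measure.smul_apply, Measure.finsetSum_apply, smul_eq_mul]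
    rw [Finset.prod_mul_distrib, Finset.prod_const, Finset.card_univ, Fintype.card_fin,
      Finset.prod_univ_sum]
    congr 1
    simp only [Fintype.piFinset_univ]
    refine Finset.sum_congr rfl fun j _ => ?_
    rw [Measure.dirac_apply' _ (MeasurableSet.univ_pi hs)]
    simp only [Measure.dirac_apply' _ (hs _), Set.indicator_apply, Set.mem_univ_pi, Pi.one_apply]
    rw [Finset.prod_ite_zero]
    simp
  rw [hpi, integral_smul_measure, integral_finsetSum_measure, productMean]
  · simp [integral_dirac]
  · exact fun j _ => integrable_dirac (by simp)

theorem measurePreserving_shift {n m : ℕ} [NeZero m] (D : Fin n → Measure ℝ)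
    [∀ i, IsProbabilityMeasure (D i)] (c : Fin n → Fin m) :
    MeasurePreserving (fun (S : Fin m → Fin n → ℝ) a i => S (a + c i) i)
      (sampleLaw D m) (sampleLaw D m) := by
  set P : Measure (Fin m × Fin n → ℝ) := Measure.pi fun p => D p.2 with hP
  have hflat : sampleLaw D m = P.map (MeasurableEquiv.curry (Fin m) (Fin n) ℝ) := by
    rw [hP, ← Measure.infinitePi_eq_pi, Measure.infinitePi_map_curry (μ := fun _ i => D i),
      Measure.infinitePi_eq_pi, sampleLaw]
    congr 1
    ext a : 1
    rw [Measure.infinitePi_eq_pi]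
  have hsh : MeasurePreserving (fun (x : Fin m × Fin n → ℝ) (p : Fin m × Fin n) => x (p.1 + c p.2, p.2)) P P := by
    have hm : Measurable fun (x : Fin m × Fin n → ℝ) (p : Fin m × Fin n) => x (p.1 + c p.2, p.2) :=
      measurable_pi_lambda _ fun p => measurable_pi_apply _
    refine ⟨hm, (Measure.pi_eq fun s hs => ?_).symm⟩
    rw [Measure.map_apply hm (MeasurableSet.univ_pi hs)]
    have : (fun (x : Fin m × Fin n → ℝ) (p : Fin m × Fin n) => x (p.1 + c p.2, p.2)) ⁻¹' Set.univ.pi s =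
        Set.univ.pi fun p => s (p.1 - c p.2, p.2) := by
      ext x
      simp only [Set.mem_preimage, Set.mem_univ_pi]
      constructor
      · intro h p
        simpa using h (p.1 - c p.2, p.2)
      · intro h p
        simpa using h (p.1 + c p.2, p.2)
    rw [this, hP, Measure.pi_pi]
    refine Finset.prod_bij' (fun p _ => (p.1 - c p.2, p.2)) (fun p _ => (p.1 + c p.2, p.2))
      ?_ ?_ ?_ ?_ ?_ <;> simp
  have hcur : MeasurePreserving (MeasurableEquiv.curry (Fin m) (Fin n) ℝ) P (sampleLaw D m) :=
    ⟨MeasurableEquiv.measurable _, hflat.symm⟩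
  have hm : Measurable fun (S : Fin m → Fin n → ℝ) a i => S (a + c i) i :=
    measurable_pi_lambda _ fun a => measurable_pi_lambda _ fun i =>
      (measurable_pi_apply (X := fun _ : Fin n => ℝ) i).comp
        (measurable_pi_apply (X := fun _ : Fin m => Fin n → ℝ) (a + c i))
  refine ⟨hm, ?_⟩
  conv_lhs => rw [← hcur.map_eq]
  rw [Measure.map_map hm hcur.measurable]
  exact (hcur.comp hsh).map_eq

section Concentration

variable {n m : ℕ} {D : Fin n → Measure ℝ} {f : (Fin n → ℝ) → ℝ} {h : ℝ}

instance [∀ i, IsProbabilityMeasure (D i)] : IsProbabilityMeasure (sampleLaw D m) := by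
  unfold sampleLaw
  infer_instance

theorem measurable_productMean (hf : Measurable f) :
    Measurable (productMean f : (Fin m → Fin n → ℝ) → ℝ) := by
  refine (Finset.measurable_fun_sum _ fun j _ => hf.comp ?_).const_mul _
  exact measurable_pi_lambda _ fun i =>
      (measurable_pi_apply (X := fun _ : Fin n => ℝ) i).comp
        (measurable_pi_apply (X := fun _ : Fin m => Fin n → ℝ) (j i))

/-- The exponential moments of `m` times the mean over all combinations of samples are at most those
of a sum of `m` independent copies: the former is an average, over shifts of the coordinates, of
such sums, and the exponential function is convex. -/
theorem integral_exp_productMean_le [∀ i, IsProbabilityMeasure (D i)] (hm : 0 < m)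
    (hf : Measurable f) (hf0 : ∀ u, 0 ≤ f u) (hfh : ∀ u, f u ≤ h) (t : ℝ) :
    Integrable (fun S => Real.exp (t * (m * productMean f S))) (sampleLaw D m) ∧
    ∫ S, Real.exp (t * (m * productMean f S)) ∂sampleLaw D m ≤
      (∫ u, Real.exp (t * f u) ∂Measure.pi D) ^ m := by
  have : NeZero m := ⟨hm.ne'⟩
  have hm' : (m : ℝ) ≠ 0 := by exact_mod_cast hm.ne'
  have hmn : (0 : ℝ) < (m : ℝ) ^ n := by positivity
  set A : (Fin n → Fin m) → (Fin m → Fin n → ℝ) → ℝ := fun c S =>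
    ∑ a, f fun i => S (a + c i) i with hA
  have hrow : ∀ (c : Fin n → Fin m) (a : Fin m),
      Measurable fun (S : Fin m → Fin n → ℝ) i => S (a + c i) i := fun c a =>
    measurable_pi_lambda _ fun i => (measurable_pi_apply (X := fun _ : Fin n => ℝ) i).comp
        (measurable_pi_apply (X := fun _ : Fin m => Fin n → ℝ) (a + c i))
  have hAm : ∀ c, Measurable (A c) := fun c =>
    Finset.measurable_fun_sum _ fun a _ => hf.comp (hrow c a)
  have havg : ∀ S : Fin m → Fin n → ℝ, m * productMean f S = ∑ c, ((m : ℝ) ^ n)⁻¹ * A c S := by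
    intro S
    rw [← Finset.mul_sum, hA, Finset.sum_comm, productMean]
    have : ∀ a : Fin m, ∑ c : Fin n → Fin m, f (fun i => S (a + c i) i) =
        ∑ j : Fin n → Fin m, f fun i => S (j i) i := fun a =>
      Fintype.sum_equiv (Equiv.addLeft fun _ => a) _ _ fun c => rfl
    simp only [this]
    rw [Finset.sum_const, Finset.card_univ, Fintype.card_fin, nsmul_eq_mul]
    ring
  have hAb : ∀ c S, |t * A c S| ≤ |t| * (m * h) := by
    intro c S
    rw [abs_mul]
    refine mul_le_mul_of_nonneg_left ?_ (abs_nonneg t)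
    rw [abs_of_nonneg (Finset.sum_nonneg fun a _ => hf0 _)]
    calc A c S ≤ ∑ _a : Fin m, h := Finset.sum_le_sum fun a _ => hfh _
      _ = m * h := by simp
  have hAi : ∀ c, Integrable (fun S => Real.exp (t * A c S)) (sampleLaw D m) := fun c => by
    refine Integrable.of_bound (Real.measurable_exp.comp ((hAm c).const_mul t)).aestronglyMeasurable
      (Real.exp (|t| * (m * h))) (ae_of_all _ fun S => ?_)
    rw [Real.norm_eq_abs, Real.abs_exp]
    exact Real.exp_le_exp.2 ((le_abs_self _).trans (hAb c S))
  have hle : ∀ S, Real.exp (t * (m * productMean f S)) ≤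
      ∑ c, ((m : ℝ) ^ n)⁻¹ * Real.exp (t * A c S) := by
    intro S
    have := convexOn_exp.map_sum_le (t := Finset.univ) (w := fun _ : Fin n → Fin m => ((m : ℝ) ^ n)⁻¹)
      (p := fun c => t * A c S) (fun _ _ => by positivity)
      (by simp [hmn.ne']) (fun _ _ => Set.mem_univ _)
    simp only [smul_eq_mul] at this
    refine le_trans (le_of_eq ?_) this
    rw [havg, Finset.mul_sum]
    congr 1
    exact Finset.sum_congr rfl fun c _ => by ring
  have hsum : Integrable (fun S => ∑ c, ((m : ℝ) ^ n)⁻¹ * Real.exp (t * A c S)) (sampleLaw D m) :=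
    integrable_finsetSum _ fun c _ => (hAi c).const_mul _
  have hmeas : Measurable fun S : Fin m → Fin n → ℝ => Real.exp (t * (m * productMean f S)) :=
    Real.measurable_exp.comp (((measurable_productMean hf).const_mul _).const_mul _)
  have hi : Integrable (fun S => Real.exp (t * (m * productMean f S))) (sampleLaw D m) :=
    hsum.mono' hmeas.aestronglyMeasurable (ae_of_all _ fun S => by
      rw [Real.norm_eq_abs, Real.abs_exp]; exact hle S)
  refine ⟨hi, (integral_mono hi hsum hle).trans ?_⟩
  have hone : ∀ c, ∫ S, Real.exp (t * A c S) ∂sampleLaw D m =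
      (∫ u, Real.exp (t * f u) ∂Measure.pi D) ^ m := by
    intro c
    have hmp := measurePreserving_shift (m := m) D c
    have hg : Measurable fun S : Fin m → Fin n → ℝ => Real.exp (t * ∑ a, f (S a)) :=
      Real.measurable_exp.comp ((Finset.measurable_fun_sum _ fun a _ =>
        hf.comp (measurable_pi_apply (X := fun _ : Fin m => Fin n → ℝ) a)).const_mul t)
    have h1 : ∫ S, Real.exp (t * A c S) ∂sampleLaw D m =
        ∫ S, Real.exp (t * ∑ a, f (S a)) ∂sampleLaw D m := by
      conv_rhs => rw [← hmp.map_eq]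
      rw [integral_map hmp.measurable.aemeasurable hg.aestronglyMeasurable]
    rw [h1]
    have h2 : ∀ S : Fin m → Fin n → ℝ, Real.exp (t * ∑ a, f (S a)) =
        ∏ a, Real.exp (t * f (S a)) := fun S => by rw [Finset.mul_sum, Real.exp_sum]
    simp only [h2, sampleLaw]
    rw [integral_fintype_prod_eq_pow (fun u : Fin n → ℝ => Real.exp (t * f u)),
      Fintype.card_fin]
  rw [integral_finsetSum _ fun c _ => (hAi c).const_mul _]
  simp only [integral_const_mul, hone]
  rw [Finset.sum_const, Finset.card_univ, Fintype.card_fun, Fintype.card_fin, Fintype.card_fin,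
    nsmul_eq_mul, Nat.cast_pow, ← mul_assoc, mul_inv_cancel₀ hmn.ne', one_mul]

/-- A bounded nonnegative variable has the exponential moments of a Poisson variable, at most. -/
theorem integral_exp_le {α : Type*} [MeasurableSpace α] {P : Measure α} [IsProbabilityMeasure P]
    {f : α → ℝ} (hh : 0 < h) (hf : Measurable f) (hf0 : ∀ u, 0 ≤ f u) (hfh : ∀ u, f u ≤ h) (t : ℝ) :
    ∫ u, Real.exp (t * f u) ∂P ≤ Real.exp ((∫ u, f u ∂P) * ((Real.exp (t * h) - 1) / h)) := by
  have hfi : Integrable f P := Integrable.of_bound hf.aestronglyMeasurable h (ae_of_all _ fun u => by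
    rw [Real.norm_eq_abs, abs_of_nonneg (hf0 u)]; exact hfh u)
  have hle : ∀ u, Real.exp (t * f u) ≤ 1 + f u * ((Real.exp (t * h) - 1) / h) := by
    intro u
    have h1 : f u / h ≤ 1 := (div_le_one hh).2 (hfh u)
    have := convexOn_exp.2 (Set.mem_univ 0) (Set.mem_univ (t * h)) (sub_nonneg.2 h1)
      (div_nonneg (hf0 u) hh.le) (by ring)
    simp only [smul_eq_mul, mul_zero, zero_add, Real.exp_zero, mul_one] at this
    rw [show f u / h * (t * h) = t * f u by field_simp] at this
    refine this.trans_eq ?_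
    field_simp
    ring
  have hi : Integrable (fun u => 1 + f u * ((Real.exp (t * h) - 1) / h)) P :=
    (integrable_const 1).add (hfi.mul_const _)
  have hei : Integrable (fun u => Real.exp (t * f u)) P :=
    hi.mono' (Real.measurable_exp.comp (hf.const_mul t)).aestronglyMeasurable
      (ae_of_all _ fun u => by rw [Real.norm_eq_abs, Real.abs_exp]; exact hle u)
  calc _ ≤ ∫ u, (1 + f u * ((Real.exp (t * h) - 1) / h)) ∂P := integral_mono hei hi hle
    _ = (∫ u, f u ∂P) * ((Real.exp (t * h) - 1) / h) + 1 := by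
        rw [integral_add (integrable_const 1) (hfi.mul_const _), integral_mul_const]
        simp [add_comm]
    _ ≤ _ := Real.add_one_le_exp _

theorem mgf_productMean_le [∀ i, IsProbabilityMeasure (D i)] (hm : 0 < m) (hh : 0 < h)
    (hf : Measurable f) (hf0 : ∀ u, 0 ≤ f u) (hfh : ∀ u, f u ≤ h) {s : ℝ} (hs : |s| ≤ 1) :
    ∫ S, Real.exp (s / h * (m * productMean f S)) ∂sampleLaw D m ≤
      Real.exp (m * (∫ u, f u ∂Measure.pi D) * (s + s ^ 2) / h) := by
  refine (integral_exp_productMean_le hm hf hf0 hfh (s / h)).2.trans ?_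
  refine (pow_le_pow_left₀ (integral_nonneg fun u => (Real.exp_pos _).le)
    (integral_exp_le hh hf hf0 hfh (s / h)) m).trans ?_
  rw [← Real.exp_nat_mul, Real.exp_le_exp, div_mul_cancel₀ _ hh.ne']
  have h1 : Real.exp s - 1 ≤ s + s ^ 2 := by
    have := (abs_le.1 (Real.abs_exp_sub_one_sub_id_le hs)).2
    linarith
  have h2 : 0 ≤ ∫ u, f u ∂Measure.pi D := integral_nonneg hf0
  rw [← mul_assoc, mul_div_assoc]
  gcongr

theorem measure_productMean_ge_le [∀ i, IsProbabilityMeasure (D i)] (hm : 0 < m) (hh : 0 < h)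
    (hf : Measurable f) (hf0 : ∀ u, 0 ≤ f u) (hfh : ∀ u, f u ≤ h) {δ : ℝ} (hδ : 0 ≤ δ)
    (hδ1 : δ ≤ 1) :
    (sampleLaw D m).real {S | (1 + δ) * (∫ u, f u ∂Measure.pi D) + δ ≤ productMean f S} ≤
      Real.exp (-(m * δ ^ 2 / h)) := by
  have hm' : (0 : ℝ) < m := by exact_mod_cast hm
  have h1 := ProbabilityTheory.measure_ge_le_exp_mul_mgf (μ := sampleLaw D m)
    (X := fun S => m * productMean f S) (t := δ / h)
    (m * ((1 + δ) * (∫ u, f u ∂Measure.pi D) + δ)) (by positivity)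
    (integral_exp_productMean_le hm hf hf0 hfh (δ / h)).1
  simp only [mul_le_mul_iff_right₀ hm'] at h1
  refine h1.trans ?_
  have h2 := mgf_productMean_le (D := D) hm hh hf hf0 hfh (s := δ) (by rwa [abs_of_nonneg hδ])
  refine (mul_le_mul_of_nonneg_left h2 (Real.exp_pos _).le).trans ?_
  rw [← Real.exp_add, Real.exp_le_exp]
  apply le_of_eq
  ring

theorem measure_productMean_le_le [∀ i, IsProbabilityMeasure (D i)] (hm : 0 < m) (hh : 0 < h)
    (hf : Measurable f) (hf0 : ∀ u, 0 ≤ f u) (hfh : ∀ u, f u ≤ h) {δ : ℝ} (hδ : 0 ≤ δ)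
    (hδ1 : δ ≤ 1) :
    (sampleLaw D m).real {S | productMean f S ≤ (1 - δ) * (∫ u, f u ∂Measure.pi D) - δ} ≤
      Real.exp (-(m * δ ^ 2 / h)) := by
  have hm' : (0 : ℝ) < m := by exact_mod_cast hm
  have h1 := ProbabilityTheory.measure_le_le_exp_mul_mgf (μ := sampleLaw D m)
    (X := fun S => m * productMean f S) (t := -δ / h)
    (m * ((1 - δ) * (∫ u, f u ∂Measure.pi D) - δ)) (div_nonpos_of_nonpos_of_nonneg (by linarith) hh.le)
    (integral_exp_productMean_le hm hf hf0 hfh (-δ / h)).1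
  simp only [mul_le_mul_iff_right₀ hm'] at h1
  refine h1.trans ?_
  have h2 := mgf_productMean_le (D := D) hm hh hf hf0 hfh (s := -δ)
    (by rwa [abs_neg, abs_of_nonneg hδ])
  refine (mul_le_mul_of_nonneg_left h2 (Real.exp_pos _).le).trans ?_
  rw [← Real.exp_add, Real.exp_le_exp]
  apply le_of_eq
  ring

end Concentration

/-! ### The number of revenue functions of Myerson's auctions on a grid -/

section Rank

variable {n : ℕ}

/-- Bidder `i` wins the auction that ranks the reports by `ρ`: her rank is positive and the highest,
ties being broken in favour of the smaller index. -/
def RankWins (ρ : Fin n → ℝ → ℕ) (u : Fin n → ℝ) (i : Fin n) : Prop :=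
  0 < ρ i (u i) ∧ ∀ j, ρ j (u j) < ρ i (u i) ∨ (ρ j (u j) = ρ i (u i) ∧ i ≤ j)

open Classical in
/-- The revenue, as a function of a profile of reports in `G`, of the auction that ranks the reports
by `ρ` and charges the lowest winning report in `G`. It is `0` at profiles outside of `G`. -/
noncomputable def rankRevenue (G : Finset ℝ) (ρ : Fin n → ℝ → ℕ) (u : Fin n → ℝ) : ℝ :=
  if ∀ i, u i ∈ G then
    ∑ i, if RankWins ρ u i then
      sInf {t : ℝ | t ∈ G ∧ RankWins ρ (Function.update u i t) i} else 0
  else 0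

theorem RankWins.unique {ρ : Fin n → ℝ → ℕ} {u : Fin n → ℝ} {i j : Fin n} (hi : RankWins ρ u i)
    (hj : RankWins ρ u j) : i = j := by
  rcases hi.2 j with h | ⟨h, hij⟩ <;> rcases hj.2 i with h' | ⟨h', hji⟩
  · omega
  · omega
  · omega
  · exact le_antisymm hij hji

theorem rankRevenue_nonneg {G : Finset ℝ} (hG : ∀ g ∈ G, 0 ≤ g) (ρ : Fin n → ℝ → ℕ)
    (u : Fin n → ℝ) : 0 ≤ rankRevenue G ρ u := by
  rw [rankRevenue]
  split_ifs
  · refine Finset.sum_nonneg fun i _ => ?_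
    split_ifs
    · exact Real.sInf_nonneg fun t ht => hG t ht.1
    · exact le_rfl
  · exact le_rfl

theorem rankRevenue_le {G : Finset ℝ} (hG : ∀ g ∈ G, 0 ≤ g) {h : ℝ} (h0 : 0 ≤ h)
    (hh : ∀ g ∈ G, g ≤ h) (ρ : Fin n → ℝ → ℕ) (u : Fin n → ℝ) : rankRevenue G ρ u ≤ h := by
  rw [rankRevenue]
  split_ifs with hu
  · by_cases hw : ∃ i, RankWins ρ u i
    · obtain ⟨i, hi⟩ := hw
      rw [Finset.sum_eq_single i (fun j _ hji => if_neg fun hj => hji (hj.unique hi)) (by simp),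
        if_pos hi]
      have hbdd : BddBelow {t : ℝ | t ∈ G ∧ RankWins ρ (Function.update u i t) i} :=
        ⟨0, fun t ht => hG t ht.1⟩
      exact (csInf_le hbdd ⟨hu i, by rwa [Function.update_eq_self]⟩).trans (hh _ (hu i))
    · push Not at hw
      rw [Finset.sum_eq_zero fun i _ => if_neg (hw i)]
      exact h0
  · exact h0

/-- The number of pairs of a bidder and a report in `G` with a nonnegative virtual value that is at
most `reportVirtualValue (E i) g`. -/
noncomputable def virtualRank (E : Fin n → Measure ℝ) (G : Finset ℝ) (i : Fin n) (g : ℝ) : ℕ :=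
  open Classical in
  ((Finset.univ ×ˢ G).filter fun z : Fin n × ℝ => 0 ≤ reportVirtualValue (E z.1) z.2 ∧
    reportVirtualValue (E z.1) z.2 ≤ reportVirtualValue (E i) g).card

variable {E : Fin n → Measure ℝ} {G : Finset ℝ}

theorem virtualRank_le_card (i : Fin n) (g : ℝ) : virtualRank E G i g ≤ n * G.card := by
  classical
  refine (Finset.card_filter_le _ _).trans ?_
  rw [Finset.card_product, Finset.card_univ, Fintype.card_fin]

theorem virtualRank_pos_iff {i : Fin n} {g : ℝ} (hg : g ∈ G) :
    0 < virtualRank E G i g ↔ 0 ≤ reportVirtualValue (E i) g := by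
  classical
  rw [virtualRank, Finset.card_pos]
  constructor
  · rintro ⟨z, hz⟩
    have := (Finset.mem_filter.1 hz).2
    exact this.1.trans this.2
  · intro h
    exact ⟨(i, g), Finset.mem_filter.2 ⟨by simp [hg], h, le_rfl⟩⟩

theorem virtualRank_mono {i j : Fin n} {g g' : ℝ}
    (h : reportVirtualValue (E j) g' ≤ reportVirtualValue (E i) g) :
    virtualRank E G j g' ≤ virtualRank E G i g := by
  classical
  refine Finset.card_le_card fun z hz => ?_
  obtain ⟨h1, h2, h3⟩ := Finset.mem_filter.1 hz
  exact Finset.mem_filter.2 ⟨h1, h2, h3.trans h⟩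

theorem virtualRank_strictMono {i j : Fin n} {g g' : ℝ} (hg : g ∈ G)
    (h0 : 0 ≤ reportVirtualValue (E i) g)
    (h : reportVirtualValue (E j) g' < reportVirtualValue (E i) g) :
    virtualRank E G j g' < virtualRank E G i g := by
  classical
  refine Finset.card_lt_card (Finset.ssubset_iff_of_subset ?_ |>.2 ⟨(i, g), ?_, ?_⟩)
  · intro z hz
    obtain ⟨h1, h2, h3⟩ := Finset.mem_filter.1 hz
    exact Finset.mem_filter.2 ⟨h1, h2, h3.trans h.le⟩
  · exact Finset.mem_filter.2 ⟨by simp [hg], h0, le_rfl⟩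
  · intro hz
    exact absurd (Finset.mem_filter.1 hz).2.2 (not_le.2 h)

theorem rankWins_virtualRank_iff {u : Fin n → ℝ} (hu : ∀ i, u i ∈ G) (i : Fin n) :
    RankWins (virtualRank E G) u i ↔ MyersonWins E u i := by
  rw [RankWins, MyersonWins, virtualRank_pos_iff (hu i)]
  refine and_congr_right fun h0 => forall_congr' fun j => ?_
  rcases lt_trichotomy (reportVirtualValue (E j) (u j)) (reportVirtualValue (E i) (u i)) with
    h | h | h
  · simp [h, virtualRank_strictMono (hu i) h0 h]
  · have : virtualRank E G j (u j) = virtualRank E G i (u i) :=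
      le_antisymm (virtualRank_mono h.le) (virtualRank_mono h.ge)
    simp [h, this]
  · have := virtualRank_strictMono (hu j) (h0.trans h.le) h
    simp [h.asymm, h.ne', this.asymm, this.ne']

theorem sum_p_eq_rankRevenue (hE : ∀ i, IsCarriedBy (E i) G) {u : Fin n → ℝ} (hu : ∀ i, u i ∈ G) :
    ∑ i, (myersonAuction E).p u i = rankRevenue G (virtualRank E G) u := by
  rw [rankRevenue, if_pos hu]
  refine Finset.sum_congr rfl fun i _ => ?_
  have hupd : ∀ t ∈ G, ∀ j, Function.update u i t j ∈ G := fun t ht j => by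
    by_cases hj : j = i
    · subst hj; simpa using ht
    · simpa [hj] using hu j
  by_cases hw : MyersonWins E u i
  swap
  · rw [myersonAuction_p_of_not hw, if_neg (mt (rankWins_virtualRank_iff hu i).1 hw)]
  simp only [myersonAuction]
  rw [if_pos hw, if_pos ((rankWins_virtualRank_iff hu i).2 hw)]
  have hiff : ∀ t ∈ G, (RankWins (virtualRank E G) (Function.update u i t) i ↔
      MyersonWins E (Function.update u i t) i) := fun t ht => rankWins_virtualRank_iff (hupd t ht) i
  apply le_antisymm
  · refine csInf_le_csInf (bddBelow_winning E u i)
      ⟨u i, hu i, (hiff _ (hu i)).2 (by rwa [Function.update_eq_self])⟩ ?_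
    exact fun t ht => ⟨(hE i).nonneg t ht.1, (hiff t ht.1).1 ht.2⟩
  · refine le_csInf ⟨u i, (hE i).nonneg _ (hu i), by rwa [Function.update_eq_self]⟩ fun t ht => ?_
    have h3 : 0 ≤ reportVirtualValue (E i) t := by simpa using ht.2.1
    obtain ⟨a, hat, ha, hav⟩ := (hE i).exists_atom_of_nonneg h3
    have haG := (hE i).mem_of_pos ha
    refine le_trans (csInf_le ⟨0, fun t ht => (hE i).nonneg t ht.1⟩ ⟨haG, ?_⟩) hat
    exact (hiff a haG).2 (ht.2.update_mono hav.symm.le)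

/-- The rank function on the whole line that is given by a finite table on the grid `G`. -/
noncomputable def tableRank {G : Finset ℝ} (κ : Fin n × G → Fin (n * G.card + 1)) (i : Fin n)
    (g : ℝ) : ℕ :=
  open Classical in if hg : g ∈ G then κ (i, ⟨g, hg⟩) else 0

theorem rankRevenue_congr {ρ ρ' : Fin n → ℝ → ℕ} (h : ∀ i, ∀ g ∈ G, ρ i g = ρ' i g) :
    rankRevenue G ρ = rankRevenue G ρ' := by
  have hw : ∀ u : Fin n → ℝ, (∀ i, u i ∈ G) → ∀ i, RankWins ρ u i ↔ RankWins ρ' u i := by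
    intro u hu i
    simp only [RankWins, fun j => h j (u j) (hu j)]
  ext u
  simp only [rankRevenue]
  split_ifs with hu
  · refine Finset.sum_congr rfl fun i _ => ?_
    have hset : {t : ℝ | t ∈ G ∧ RankWins ρ (Function.update u i t) i} =
        {t : ℝ | t ∈ G ∧ RankWins ρ' (Function.update u i t) i} := by
      ext t
      refine and_congr_right fun ht => hw _ (fun j => ?_) i
      by_cases hj : j = i
      · subst hj; simpa using ht
      · simpa [hj] using hu j
    rw [hset]
    by_cases hi : RankWins ρ u i
    · rw [if_pos hi, if_pos ((hw u hu i).1 hi)]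
    · rw [if_neg hi, if_neg (mt (hw u hu i).2 hi)]
  · rfl

/-- On the grid, the revenue of Myerson's auction is one of `(n |G| + 1) ^ (n |G|)` functions. -/
theorem exists_table (hE : ∀ i, IsCarriedBy (E i) G) :
    ∃ κ : Fin n × G → Fin (n * G.card + 1), ∀ u : Fin n → ℝ, (∀ i, u i ∈ G) →
      ∑ i, (myersonAuction E).p u i = rankRevenue G (tableRank κ) u := by
  refine ⟨fun z => ⟨virtualRank E G z.1 z.2, Nat.lt_succ_of_le (virtualRank_le_card _ _)⟩,
    fun u hu => ?_⟩
  rw [sum_p_eq_rankRevenue hE hu]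
  refine congrFun (rankRevenue_congr fun i g hg => ?_) u
  rw [tableRank, dif_pos hg]

theorem card_table_add_one_le {A : ℝ} (hA : 1 ≤ A) (hk : ((n * G.card : ℕ) : ℝ) ≤ A) :
    (Fintype.card (Fin n × G → Fin (n * G.card + 1)) : ℝ) + 1 ≤
      Real.exp (2 * (A * (1 + Real.log A))) := by
  set k := n * G.card with hkd
  have hB : 1 ≤ A * (1 + Real.log A) := by nlinarith [Real.log_nonneg hA]
  have h1 : (Fintype.card (Fin n × G → Fin (k + 1)) : ℝ) ≤ Real.exp (A * (1 + Real.log A)) := by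
    rw [Fintype.card_fun, Fintype.card_fin, Fintype.card_prod, Fintype.card_fin, Fintype.card_coe,
      ← hkd]
    push_cast
    calc ((k : ℝ) + 1) ^ k = Real.exp (k * Real.log (k + 1)) := by
          rw [Real.exp_nat_mul, Real.exp_log (by positivity)]
      _ ≤ Real.exp (A * (1 + Real.log A)) := by
          rw [Real.exp_le_exp]
          have hl : Real.log (k + 1) ≤ 1 + Real.log A := by
            calc Real.log (k + 1) ≤ Real.log (Real.exp 1 * A) := by
                  apply Real.log_le_log (by positivity)
                  have := Real.add_one_le_exp 1
                  nlinarith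
              _ = 1 + Real.log A := by
                  rw [Real.log_mul (Real.exp_pos 1).ne' (by positivity), Real.log_exp]
          have : 0 ≤ Real.log (k + 1 : ℝ) := Real.log_nonneg (by linarith [(Nat.cast_nonneg k : (0 : ℝ) ≤ k)])
          gcongr
  have h2 := Real.one_le_exp (zero_le_one.trans hB)
  calc _ ≤ Real.exp 1 * Real.exp (A * (1 + Real.log A)) := by
        have := Real.add_one_le_exp 1
        nlinarith
    _ ≤ _ := by
        rw [← Real.exp_add, Real.exp_le_exp]
        linarith

end Rank

/-! ### Optimal revenue -/

section Main

variable {n : ℕ} {D : Fin n → Measure ℝ} {h ε : ℝ}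

theorem rev_le [∀ i, IsProbabilityMeasure (D i)] (hh : 0 ≤ h)
    (hD : ∀ i, ∀ᵐ w ∂(D i), w ∈ Set.Icc 0 h) {M : Mechanism n} (hM : M.IsAdmissible)
    (hint : Integrable (fun v => ∑ i, M.p v i) (Measure.pi D)) : M.rev D ≤ h := by
  calc M.rev D ≤ ∫ _, h ∂Measure.pi D := by
        refine integral_mono_ae hint (integrable_const h) ?_
        filter_upwards [ae_forall_mem_Icc hD] with v hv
        exact hM.sum_p_le (fun j => (hv j).1) hh fun j => (hv j).2
    _ = h := by simp

theorem zero_isAdmissible : Mechanism.IsAdmissible (⟨fun _ _ => 0, fun _ _ => 0⟩ : Mechanism n) where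
  measurable_x := measurable_const
  measurable_p := measurable_const
  feasible := fun _ _ => by simp
  dsic := fun _ _ _ _ _ => by simp
  ir := fun _ _ _ => by simp

theorem optRev_set_nonempty (D : Fin n → Measure ℝ) :
    {r : ℝ | ∃ M : Mechanism n, M.IsAdmissible ∧
      Integrable (fun v => ∑ i, M.p v i) (Measure.pi D) ∧ r = M.rev D}.Nonempty :=
  ⟨_, ⟨fun _ _ => 0, fun _ _ => 0⟩, zero_isAdmissible, by simp, rfl⟩

theorem rev_le_optRev [∀ i, IsProbabilityMeasure (D i)] (hh : 0 ≤ h)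
    (hD : ∀ i, ∀ᵐ w ∂(D i), w ∈ Set.Icc 0 h) {M : Mechanism n} (hM : M.IsAdmissible)
    (hint : Integrable (fun v => ∑ i, M.p v i) (Measure.pi D)) : M.rev D ≤ optRev D := by
  refine le_csSup ⟨h, ?_⟩ ⟨M, hM, hint, rfl⟩
  rintro _ ⟨M', hM', hint', rfl⟩
  exact rev_le hh hD hM' hint'

open Classical in
/-- Offering the item to bidder `i` at price `1`. -/
noncomputable def unitPrice (i : Fin n) : Mechanism n where
  x v j := if j = i ∧ 1 ≤ v i then 1 else 0
  p v j := if j = i ∧ 1 ≤ v i then 1 else 0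

theorem unitPrice_isAdmissible (i : Fin n) : (unitPrice i).IsAdmissible := by
  classical
  have hm : Measurable fun (v : Fin n → ℝ) (j : Fin n) => if j = i ∧ 1 ≤ v i then (1 : ℝ) else 0 := by
    refine measurable_pi_lambda _ fun j => Measurable.ite ?_ measurable_const measurable_const
    by_cases hj : j = i
    · simpa [hj] using measurableSet_le measurable_const (measurable_pi_apply i)
    · simp [hj]
  refine ⟨hm, hm, fun v _ => ⟨fun j => ?_, ?_⟩, fun v _ j b _ => ?_, fun v _ j => ?_⟩
  · simp only [unitPrice]; split_ifs <;> norm_num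
  · simp only [unitPrice]
    rw [Finset.sum_eq_single i (fun j _ hj => if_neg fun h => hj h.1) (by simp)]
    split_ifs <;> norm_num
  · simp only [unitPrice]
    by_cases hj : j = i
    · subst hj
      simp only [true_and, Function.update_self]
      split_ifs <;> linarith
    · simp [hj]
  · simp only [unitPrice]
    by_cases hj : j = i
    · subst hj
      simp only [true_and]
      split_ifs <;> linarith
    · simp [hj]

theorem one_le_optRev [∀ i, IsProbabilityMeasure (D i)] (hh : 1 ≤ h)
    (hD : ∀ i, ∀ᵐ w ∂(D i), w ∈ Set.Icc 1 h) (i : Fin n) : 1 ≤ optRev D := by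
  have hae : ∀ᵐ v ∂Measure.pi D, ∑ j, (unitPrice i).p v j = 1 := by
    filter_upwards [ae_forall_mem_Icc hD] with v hv
    simp only [unitPrice]
    rw [Finset.sum_eq_single i (fun j _ hj => if_neg fun h => hj h.1) (by simp),
      if_pos ⟨rfl, (hv i).1⟩]
  have hint : Integrable (fun v => ∑ j, (unitPrice i).p v j) (Measure.pi D) :=
    (integrable_const (1 : ℝ)).congr (hae.mono fun v hv => hv.symm)
  have hrev : (unitPrice i).rev D = 1 := by
    rw [Mechanism.rev, integral_congr_ae hae]
    simp
  rw [← hrev]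
  exact rev_le_optRev (zero_le_one.trans hh) (fun j => (hD j).mono fun w hw =>
    ⟨zero_le_one.trans hw.1, hw.2⟩) (unitPrice_isAdmissible i) hint

/-! ### Rounded distributions -/

theorem isCarriedBy_map_roundDown {μ : Measure ℝ} [IsProbabilityMeasure μ] (h0 : 0 < ε)
    (h1 : ε < 1) (hμ : ∀ᵐ w ∂μ, w ∈ Set.Icc 1 h) :
    IsCarriedBy (μ.map (roundDown ε)) (powerGrid h ε) where
  isProb := Measure.isProbabilityMeasure_map (measurable_roundDown h1).aemeasurable
  nonneg g hg := zero_le_one.trans (one_le_of_mem_powerGrid h0 h1 hg)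
  compl_null := by
    rw [← mem_ae_iff, mem_ae_map_iff (measurable_roundDown h1).aemeasurable
      (powerGrid h ε).measurableSet]
    filter_upwards [hμ] with w hw
    exact roundDown_mem_powerGrid h0 h1 hw

theorem isStaircase_of_powerGrid {μ : Measure ℝ} (h0 : 0 < ε) (h1 : ε < 1)
    (hμ : IsCarriedBy μ (powerGrid h ε)) : IsStaircase ε μ :=
  hμ.isStaircase fun _ hg => roundDown_of_mem_powerGrid h0 h1 hg

/-- On distributions that live on the grid, rounding the reports has no effect. -/
theorem rev_roundedMyerson_of_powerGrid (h0 : 0 < ε) (h1 : ε < 1) (E : Fin n → Measure ℝ)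
    {μ : Fin n → Measure ℝ} (hμ : ∀ i, IsCarriedBy (μ i) (powerGrid h ε)) :
    (roundedMyerson ε E).rev μ = (myersonAuction E).rev μ := by
  refine integral_congr_ae ?_
  filter_upwards [mem_ae_iff.2 (pi_compl_null hμ)] with u hu
  have : (fun i => roundDown ε (u i)) = u :=
    funext fun i => roundDown_of_mem_powerGrid h0 h1 (hu i (Set.mem_univ i))
  simp only [roundedMyerson, this]

theorem rev_map_roundDown [∀ i, IsProbabilityMeasure (D i)] (h0 : 0 < ε) (h1 : ε < 1)
    (hD : ∀ i, ∀ᵐ w ∂(D i), w ∈ Set.Icc 1 h) (E : Fin n → Measure ℝ) :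
    (myersonAuction E).rev (fun i => (D i).map (roundDown ε)) = (roundedMyerson ε E).rev D := by
  have hμ := fun i => isCarriedBy_map_roundDown h0 h1 (hD i)
  have := fun i => (hμ i).isProb
  have hmap : Measure.pi (fun i => (D i).map (roundDown ε)) =
      (Measure.pi D).map fun v i => roundDown ε (v i) :=
    (Measure.pi_map_pi fun i => (measurable_roundDown h1).aemeasurable).symm
  have hi := integrable_pi_of_isCarriedBy hμ fun u => ∑ i, (myersonAuction E).p u i
  rw [Mechanism.rev, hmap, integral_map]
  · rfl
  · exact (measurable_pi_lambda _ fun i =>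
      (measurable_roundDown h1).comp (measurable_pi_apply i)).aemeasurable
  · rw [← hmap]
    exact hi.aestronglyMeasurable

/-- Myerson's auction for the rounded distribution loses at most a factor `1 - ε`. -/
theorem mul_optRev_le_rev [∀ i, IsProbabilityMeasure (D i)] (hh : 0 ≤ h) (h0 : 0 < ε) (h1 : ε < 1)
    (hD : ∀ i, ∀ᵐ w ∂(D i), w ∈ Set.Icc 1 h) :
    (1 - ε) * optRev D ≤ (myersonAuction fun i => (D i).map (roundDown ε)).rev
      fun i => (D i).map (roundDown ε) := by
  have hε : 0 < 1 - ε := by linarith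
  rw [mul_comm, ← le_div_iff₀ hε]
  refine csSup_le (optRev_set_nonempty D) ?_
  rintro _ ⟨M, hM, hint, rfl⟩
  rw [le_div_iff₀ hε, mul_comm]
  exact hM.mul_rev_le_myerson (fun i => (hD i).mono fun w hw => ⟨zero_le_one.trans hw.1, hw.2⟩)
    hh hε.le (measurable_roundDown h1) (monotone_roundDown h1)
    (fun w hw => mul_le_roundDown h0 h1 hw)
    (fun i => isCarriedBy_map_roundDown h0 h1 (hD i)) hint

theorem mul_optRev_le_optRev_map [∀ i, IsProbabilityMeasure (D i)] (hh : 0 ≤ h) (h0 : 0 < ε)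
    (h1 : ε < 1) (hD : ∀ i, ∀ᵐ w ∂(D i), w ∈ Set.Icc 1 h) :
    (1 - ε) * optRev D ≤ optRev fun i => (D i).map (roundDown ε) := by
  refine (mul_optRev_le_rev hh h0 h1 hD).trans ?_
  have hμ := fun i => isCarriedBy_map_roundDown h0 h1 (hD i)
  have := fun i => (hμ i).isProb
  rw [← rev_roundedMyerson_of_powerGrid h0 h1 _ hμ]
  refine rev_le_optRev hh (fun i => ?_)
    (roundedMyerson_isAdmissible h0 h1 fun i => isStaircase_of_powerGrid h0 h1 (hμ i))
    (integrable_pi_of_isCarriedBy hμ _)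
  filter_upwards [mem_ae_iff.2 (hμ i).compl_null] with w hw
  exact ⟨(hμ i).nonneg w hw, le_of_mem_powerGrid hw⟩

/-! ### The empirical Myerson auction -/

variable {m : ℕ}

theorem rev_empiricalMyerson_nonneg (S : Fin m → Fin n → ℝ) : 0 ≤ (empiricalMyerson ε S).rev D :=
  integral_nonneg fun _ => myersonAuction_sum_p_nonneg _ _

theorem isCarriedBy_empirical_roundDown (h0 : 0 < ε) (h1 : ε < 1) (hm : 0 < m)
    {S : Fin m → Fin n → ℝ} (hS : ∀ a i, S a i ∈ Set.Icc 1 h) (i : Fin n) :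
    IsCarriedBy (empiricalMeasure fun j => roundDown ε (S j i)) (powerGrid h ε) :=
  isCarriedBy_empiricalMeasure hm
    (fun _ hg => zero_le_one.trans (one_le_of_mem_powerGrid h0 h1 hg))
    fun j => roundDown_mem_powerGrid h0 h1 (hS j i)

/-- The revenue function with the table `κ`, on rounded values. -/
noncomputable def tableRevenue (h ε : ℝ)
    (κ : Fin n × powerGrid h ε → Fin (n * (powerGrid h ε).card + 1)) (v : Fin n → ℝ) : ℝ :=
  rankRevenue (powerGrid h ε) (tableRank κ) fun i => roundDown ε (v i)

theorem measurable_tableRevenue (h0 : 0 < ε) (h1 : ε < 1)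
    (κ : Fin n × powerGrid h ε → Fin (n * (powerGrid h ε).card + 1)) :
    Measurable (tableRevenue h ε κ) :=
  measurable_comp_roundDown h0 h1 (rankRevenue (powerGrid h ε) (tableRank κ)) measurable_id

theorem rev_roundedMyerson_eq [∀ i, IsProbabilityMeasure (D i)] (h0 : 0 < ε) (h1 : ε < 1)
    (hD : ∀ i, ∀ᵐ w ∂(D i), w ∈ Set.Icc 1 h) {E : Fin n → Measure ℝ}
    {κ : Fin n × powerGrid h ε → Fin (n * (powerGrid h ε).card + 1)}
    (hκ : ∀ u : Fin n → ℝ, (∀ i, u i ∈ powerGrid h ε) →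
      ∑ i, (myersonAuction E).p u i = rankRevenue (powerGrid h ε) (tableRank κ) u) :
    (roundedMyerson ε E).rev D = ∫ v, tableRevenue h ε κ v ∂Measure.pi D := by
  refine integral_congr_ae ?_
  filter_upwards [ae_forall_mem_Icc hD] with v hv
  exact hκ _ fun i => roundDown_mem_powerGrid h0 h1 (hv i)

theorem productMean_tableRevenue (h0 : 0 < ε) (h1 : ε < 1) (hm : 0 < m)
    {S : Fin m → Fin n → ℝ} (hS : ∀ a i, S a i ∈ Set.Icc 1 h) {E : Fin n → Measure ℝ}
    {κ : Fin n × powerGrid h ε → Fin (n * (powerGrid h ε).card + 1)}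
    (hκ : ∀ u : Fin n → ℝ, (∀ i, u i ∈ powerGrid h ε) →
      ∑ i, (myersonAuction E).p u i = rankRevenue (powerGrid h ε) (tableRank κ) u) :
    productMean (tableRevenue h ε κ) S =
      (myersonAuction E).rev fun i => empiricalMeasure fun j => roundDown ε (S j i) := by
  have h2 : productMean (tableRevenue h ε κ) S =
      productMean (rankRevenue (powerGrid h ε) (tableRank κ)) fun a i => roundDown ε (S a i) := rfl
  rw [h2, ← integral_pi_empiricalMeasure hm]
  refine integral_congr_ae ?_
  filter_upwards [mem_ae_iff.2 (pi_compl_null fun i =>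
    isCarriedBy_empirical_roundDown h0 h1 hm hS i)] with u hu
  exact (hκ u fun i => hu i (Set.mem_univ i)).symm

/-- If the expectations of all revenue functions under the product of the empirical distributions
are not much larger than their true expectations, and that of the optimal revenue function is not
much smaller, then the empirical Myerson auction is nearly optimal. -/
theorem le_rev_empiricalMyerson [∀ i, IsProbabilityMeasure (D i)] (hn : 0 < n) (hh : 1 ≤ h)
    (h0 : 0 < ε) (h1 : ε < 1) (hD : ∀ i, ∀ᵐ w ∂(D i), w ∈ Set.Icc 1 h) (hm : 0 < m)
    {S : Fin m → Fin n → ℝ} (hS : ∀ a i, S a i ∈ Set.Icc 1 h)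
    {κ₀ : Fin n × powerGrid h ε → Fin (n * (powerGrid h ε).card + 1)}
    (hκ₀ : ∀ u : Fin n → ℝ, (∀ i, u i ∈ powerGrid h ε) →
      ∑ i, (myersonAuction fun i => (D i).map (roundDown ε)).p u i =
        rankRevenue (powerGrid h ε) (tableRank κ₀) u)
    (hup : ∀ κ, productMean (tableRevenue h ε κ) S <
      (1 + ε) * (∫ v, tableRevenue h ε κ v ∂Measure.pi D) + ε)
    (hlow : (1 - ε) * (∫ v, tableRevenue h ε κ₀ v ∂Measure.pi D) - ε <
      productMean (tableRevenue h ε κ₀) S) :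
    (1 - 5 * ε) * optRev D ≤ (empiricalMyerson ε S).rev D := by
  have hE := fun i => isCarriedBy_empirical_roundDown h0 h1 hm hS i
  have hμ := fun i => isCarriedBy_map_roundDown h0 h1 (hD i)
  have hEprob := fun i => (hE i).isProb
  obtain ⟨κ, hκ⟩ := exists_table hE
  have e1 : (empiricalMyerson ε S).rev D = ∫ v, tableRevenue h ε κ v ∂Measure.pi D :=
    rev_roundedMyerson_eq h0 h1 hD hκ
  have e2 : (1 - ε) * optRev D ≤ ∫ v, tableRevenue h ε κ₀ v ∂Measure.pi D := by
    rw [← rev_roundedMyerson_eq h0 h1 hD hκ₀, ← rev_map_roundDown h0 h1 hD]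
    exact mul_optRev_le_rev (zero_le_one.trans hh) h0 h1 hD
  -- Myerson's auction for the empirical distributions is optimal for them.
  have e3 : productMean (tableRevenue h ε κ₀) S ≤ productMean (tableRevenue h ε κ) S := by
    rw [productMean_tableRevenue h0 h1 hm hS hκ₀, productMean_tableRevenue h0 h1 hm hS hκ,
      ← rev_roundedMyerson_of_powerGrid h0 h1 _ hE]
    have hadm := roundedMyerson_isAdmissible h0 h1
      (E := fun i => (D i).map (roundDown ε)) fun i => isStaircase_of_powerGrid h0 h1 (hμ i)
    have hae : ∀ i, ∀ᵐ w ∂(empiricalMeasure fun j => roundDown ε (S j i)), w ∈ Set.Icc 0 h := by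
      intro i
      filter_upwards [mem_ae_iff.2 (hE i).compl_null] with w hw
      exact ⟨(hE i).nonneg w hw, le_of_mem_powerGrid hw⟩
    have := hadm.mul_rev_le_myerson (r := id) (c := 1) hae (zero_le_one.trans hh) zero_le_one
      measurable_id monotone_id (fun w _ => (one_mul w).le)
      (fun i => by rw [Measure.map_id]; exact hE i) (integrable_pi_of_isCarriedBy hE _)
    simpa only [Measure.map_id, one_mul] using this
  have e4 := hup κ
  rw [← e1] at e4
  have e5 := one_le_optRev hh hD ⟨0, hn⟩
  have e6 : (1 + ε) * ((1 - 5 * ε) * optRev D) ≤ (1 + ε) * (empiricalMyerson ε S).rev D := by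
    have := mul_le_mul_of_nonneg_left e2 (show 0 ≤ 1 - ε by linarith)
    nlinarith [mul_pos h0 h0, mul_pos h0 (show 0 < optRev D by linarith),
      mul_nonneg (mul_pos h0 h0).le (show 0 ≤ optRev D by linarith)]
  exact le_of_mul_le_mul_left e6 (by linarith)

theorem ae_sampleLaw_mem_Icc [∀ i, IsProbabilityMeasure (D i)]
    (hD : ∀ i, ∀ᵐ w ∂(D i), w ∈ Set.Icc 1 h) :
    ∀ᵐ S ∂sampleLaw D m, ∀ a i, S a i ∈ Set.Icc 1 h :=
  ae_all_iff.2 fun a => (Measure.tendsto_eval_ae_ae (μ := fun _ : Fin m => Measure.pi D)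
    (i := a)).eventually (ae_forall_mem_Icc hD)

/-- The union bound over all revenue functions. -/
theorem measureReal_rev_lt_le [∀ i, IsProbabilityMeasure (D i)] (hn : 0 < n) (hh : 1 ≤ h)
    (h0 : 0 < ε) (h1 : ε < 1) (hD : ∀ i, ∀ᵐ w ∂(D i), w ∈ Set.Icc 1 h) (hm : 0 < m) :
    (sampleLaw D m).real {S | (empiricalMyerson ε S).rev D < (1 - 5 * ε) * optRev D} ≤
      ((Fintype.card (Fin n × powerGrid h ε → Fin (n * (powerGrid h ε).card + 1)) : ℝ) + 1) *
        Real.exp (-(m * ε ^ 2 / h)) := by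
  have hh0 : 0 < h := zero_lt_one.trans_le hh
  obtain ⟨κ₀, hκ₀⟩ := exists_table fun i => isCarriedBy_map_roundDown h0 h1 (hD i)
  set up : (Fin n × powerGrid h ε → Fin (n * (powerGrid h ε).card + 1)) →
      Set (Fin m → Fin n → ℝ) := fun κ =>
    {S | (1 + ε) * (∫ v, tableRevenue h ε κ v ∂Measure.pi D) + ε ≤
      productMean (tableRevenue h ε κ) S} with hup
  set low : Set (Fin m → Fin n → ℝ) :=
    {S | productMean (tableRevenue h ε κ₀) S ≤
      (1 - ε) * (∫ v, tableRevenue h ε κ₀ v ∂Measure.pi D) - ε} with hlow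
  have hpos : ∀ κ v, 0 ≤ tableRevenue (n := n) h ε κ v := fun κ v =>
    rankRevenue_nonneg (fun g hg => zero_le_one.trans (one_le_of_mem_powerGrid h0 h1 hg)) _ _
  have hbd : ∀ κ v, tableRevenue (n := n) h ε κ v ≤ h := fun κ v =>
    rankRevenue_le (fun g hg => zero_le_one.trans (one_le_of_mem_powerGrid h0 h1 hg)) hh0.le
      (fun g hg => le_of_mem_powerGrid hg) _ _
  have hsub : {S | (empiricalMyerson ε S).rev D < (1 - 5 * ε) * optRev D} ≤ᵐ[sampleLaw D m]
      ((⋃ κ, up κ) ∪ low : Set _) := by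
    filter_upwards [ae_sampleLaw_mem_Icc hD] with S hS hlt
    by_contra hc
    have hc1 : ∀ κ, S ∉ up κ := fun κ hκ => hc (Or.inl (Set.mem_iUnion.2 ⟨κ, hκ⟩))
    have hc2 : S ∉ low := fun hl => hc (Or.inr hl)
    exact absurd (le_rev_empiricalMyerson hn hh h0 h1 hD hm hS hκ₀ (fun κ => not_le.1 (hc1 κ))
      (not_le.1 hc2)) (not_le.2 hlt)
  calc _ ≤ (sampleLaw D m).real ((⋃ κ, up κ) ∪ low) :=
        ENNReal.toReal_mono (measure_ne_top _ _) (measure_mono_ae hsub)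
    _ ≤ (∑ κ, (sampleLaw D m).real (up κ)) + (sampleLaw D m).real low :=
        (measureReal_union_le _ _).trans (by gcongr; exact measureReal_iUnion_fintype_le _)
    _ ≤ (∑ _κ : Fin n × powerGrid h ε → Fin (n * (powerGrid h ε).card + 1),
          Real.exp (-(m * ε ^ 2 / h))) + Real.exp (-(m * ε ^ 2 / h)) := by
        gcongr with κ
        · exact measure_productMean_ge_le hm hh0 (measurable_tableRevenue h0 h1 κ) (hpos κ) (hbd κ)
            h0.le h1.le
        · exact measure_productMean_le_le hm hh0 (measurable_tableRevenue h0 h1 κ₀) (hpos κ₀)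
            (hbd κ₀) h0.le h1.le
    _ = _ := by
        rw [Finset.sum_const, Finset.card_univ, nsmul_eq_mul]
        ring

/-! ### The number of samples -/

theorem one_le_levels (hn : 0 < n) (hh : 1 ≤ h) (h0 : 0 < ε) (h1 : ε < 1) :
    1 ≤ n * (1 + Real.log h) / ε := by
  have hn' : (1 : ℝ) ≤ n := by exact_mod_cast hn
  have := Real.log_nonneg hh
  rw [le_div_iff₀ h0]
  nlinarith

theorem sampleSize_eq (hh : 1 ≤ h) (h0 : 0 < ε) :
    sampleSize n h ε = h / ε ^ 2 *
      (n * (1 + Real.log h) / ε * (1 + Real.log (n * (1 + Real.log h) / ε))) := by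
  rw [sampleSize]
  field_simp

/-- The high-probability guarantee. -/
theorem measure_rev_lt_le [∀ i, IsProbabilityMeasure (D i)] (hn : 0 < n) (hh : 1 ≤ h)
    (h0 : 0 < ε) (h1 : ε < 1) (hD : ∀ i, ∀ᵐ w ∂(D i), w ∈ Set.Icc 1 h) {γ : ℝ} (hγ : 0 < γ)
    (hγ1 : γ < 1) (hm : 2 * (sampleSize n h ε + h / ε ^ 2 * Real.log (1 / γ)) ≤ m) :
    (sampleLaw D m).real {S | (empiricalMyerson ε S).rev D < (1 - 5 * ε) * optRev D} ≤ γ := by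
  have hh0 : 0 < h := zero_lt_one.trans_le hh
  have hA := one_le_levels hn hh h0 h1
  rw [sampleSize_eq hh h0] at hm
  set A := n * (1 + Real.log h) / ε with hAd
  set B := A * (1 + Real.log A) with hB
  have hB1 : 1 ≤ B := by nlinarith [Real.log_nonneg hA]
  have hL : 0 < Real.log (1 / γ) := Real.log_pos ((one_lt_div hγ).2 hγ1)
  have hm0 : 0 < m := by
    have : (0 : ℝ) < m := lt_of_lt_of_le (by positivity) hm
    exact_mod_cast this
  have hexp : 2 * B + 2 * Real.log (1 / γ) ≤ m * ε ^ 2 / h := by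
    rw [le_div_iff₀ hh0]
    calc _ = 2 * (h / ε ^ 2 * B + h / ε ^ 2 * Real.log (1 / γ)) * ε ^ 2 := by field_simp
      _ ≤ m * ε ^ 2 := by gcongr
  have hcard : ((n * (powerGrid h ε).card : ℕ) : ℝ) ≤ A := by
    rw [hAd, mul_div_assoc]
    push_cast
    gcongr
    exact card_powerGrid_le hh h0 h1
  calc _ ≤ _ := measureReal_rev_lt_le hn hh h0 h1 hD hm0
    _ ≤ Real.exp (2 * B) * Real.exp (-(m * ε ^ 2 / h)) := by
        gcongr
        exact card_table_add_one_le hA hcard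
    _ ≤ Real.exp (-Real.log (1 / γ)) := by
        rw [← Real.exp_add, Real.exp_le_exp]
        linarith
    _ = γ := by rw [one_div, Real.log_inv, neg_neg, Real.exp_log hγ]

theorem empiricalMyerson_eq (S : Fin m → Fin n → ℝ) : empiricalMyerson ε S =
    roundedMyerson ε fun i => empiricalMeasure fun j => roundDown ε (S j i) := rfl

theorem measurable_rev_empiricalMyerson (h0 : 0 < ε) (h1 : ε < 1) :
    Measurable fun S : Fin m → Fin n → ℝ => (empiricalMyerson ε S).rev D := by
  have hu : Measurable fun (S : Fin m → Fin n → ℝ) (z : Fin m × Fin n) => S z.1 z.2 :=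
    measurable_pi_lambda _ fun z => (measurable_pi_apply (X := fun _ : Fin n => ℝ) z.2).comp
      (measurable_pi_apply (X := fun _ : Fin m => Fin n → ℝ) z.1)
  have key : ∀ F : (Fin m × Fin n → ℝ) → ℝ, Measurable fun S : Fin m → Fin n → ℝ =>
      F fun z => roundDown ε (S z.1 z.2) := fun F => measurable_comp_roundDown h0 h1 F hu
  simp only [empiricalMyerson_eq]
  exact key fun R => (roundedMyerson ε fun i => empiricalMeasure fun j => R (j, i)).rev D

theorem integrable_rev_empiricalMyerson [∀ i, IsProbabilityMeasure (D i)] (hh : 1 ≤ h)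
    (h0 : 0 < ε) (h1 : ε < 1) (hD : ∀ i, ∀ᵐ w ∂(D i), w ∈ Set.Icc 1 h) :
    Integrable (fun S => (empiricalMyerson ε S).rev D) (sampleLaw D m) := by
  refine Integrable.of_bound (measurable_rev_empiricalMyerson h0 h1).aestronglyMeasurable h
    (ae_of_all _ fun S => ?_)
  rw [Real.norm_eq_abs, abs_of_nonneg (rev_empiricalMyerson_nonneg S)]
  have hbd : ∀ᵐ v ∂Measure.pi D, ∑ i, (empiricalMyerson ε S).p v i ≤ h := by
    filter_upwards [ae_forall_mem_Icc hD] with v hv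
    refine myersonAuction_sum_p_le _ (fun i => roundDown_nonneg h1 _) (zero_le_one.trans hh)
      fun i => (roundDown_le h0 h1 (zero_le_one.trans (hv i).1)).trans (hv i).2
  have hm : Measurable fun v => ∑ i, (empiricalMyerson ε S).p v i :=
    Finset.measurable_fun_sum _ fun i _ =>
      (measurable_pi_apply i).comp (empiricalMyerson_isAdmissible h0 h1 S).measurable_p
  calc _ ≤ ∫ _, h ∂Measure.pi D := by
        refine integral_mono_of_nonneg (ae_of_all _ fun v => myersonAuction_sum_p_nonneg _ _)
          (integrable_const h) hbd
    _ = h := by simp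

/-- The guarantee in expectation, from the high-probability one with failure probability `ε`. -/
theorem le_integral_rev [∀ i, IsProbabilityMeasure (D i)] (hn : 0 < n) (hh : 1 ≤ h)
    (h0 : 0 < ε) (h1 : ε < 1) (hD : ∀ i, ∀ᵐ w ∂(D i), w ∈ Set.Icc 1 h)
    (hm : 4 * sampleSize n h ε ≤ m) :
    (1 - 6 * ε) * optRev D ≤ ∫ S, (empiricalMyerson ε S).rev D ∂sampleLaw D m := by
  have hh0 : 0 < h := zero_lt_one.trans_le hh
  have hO : 1 ≤ optRev D := one_le_optRev hh hD ⟨0, hn⟩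
  have hnn : 0 ≤ ∫ S, (empiricalMyerson ε S).rev D ∂sampleLaw D m :=
    integral_nonneg fun S => rev_empiricalMyerson_nonneg S
  rcases le_or_gt (1 - 5 * ε) 0 with h5 | h5
  · exact le_trans (mul_nonpos_of_nonpos_of_nonneg (by linarith) (by linarith)) hnn
  have hlog : h / ε ^ 2 * Real.log (1 / ε) ≤ sampleSize n h ε := by
    have hA := one_le_levels hn hh h0 h1
    rw [sampleSize_eq hh h0]
    set A := n * (1 + Real.log h) / ε with hAd
    have hl : Real.log (1 / ε) ≤ Real.log A := by
      apply Real.log_le_log (by positivity)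
      rw [hAd]
      have hn' : (1 : ℝ) ≤ n := by exact_mod_cast hn
      gcongr
      nlinarith [Real.log_nonneg hh]
    gcongr
    nlinarith [Real.log_nonneg hA]
  have hprob := measure_rev_lt_le (D := D) (m := m) hn hh h0 h1 hD h0 h1 (by linarith)
  have hmeas : MeasurableSet {S : Fin m → Fin n → ℝ |
      (empiricalMyerson ε S).rev D < (1 - 5 * ε) * optRev D} :=
    measurableSet_lt (measurable_rev_empiricalMyerson h0 h1) measurable_const
  set bad := {S : Fin m → Fin n → ℝ | (empiricalMyerson ε S).rev D < (1 - 5 * ε) * optRev D}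
  have hgood : 1 - ε ≤ (sampleLaw D m).real badᶜ := by
    rw [probReal_compl_eq_one_sub hmeas]
    linarith
  calc (1 - 6 * ε) * optRev D ≤ (sampleLaw D m).real badᶜ * ((1 - 5 * ε) * optRev D) := by
        have := mul_le_mul_of_nonneg_right hgood (mul_nonneg h5.le (zero_le_one.trans hO))
        nlinarith [mul_nonneg (mul_pos h0 h0).le (zero_le_one.trans hO)]
    _ = ∫ S, badᶜ.indicator (fun _ => (1 - 5 * ε) * optRev D) S ∂sampleLaw D m := by
        rw [integral_indicator hmeas.compl, setIntegral_const, smul_eq_mul]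
    _ ≤ _ := by
        refine integral_mono ((integrable_const _).indicator hmeas.compl)
          (integrable_rev_empiricalMyerson hh h0 h1 hD) fun S => ?_
        by_cases hS : S ∈ bad
        · rw [Set.indicator_of_notMem (by simpa using hS)]
          exact rev_empiricalMyerson_nonneg S
        · rw [Set.indicator_of_mem (by simpa using hS)]
          exact not_lt.1 hS

end Main

theorem mainTheorem5 :
    -- Rounding down to powers of `1 - ε` loses at most a factor `1 - ε` of the optimal revenue.
    (∀ (n : ℕ) (h ε : ℝ), 1 ≤ h → 0 < ε → ε < 1 →
      ∀ D : Fin n → Measure ℝ, (∀ i, IsProbabilityMeasure (D i)) →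
        (∀ i, ∀ᵐ v ∂(D i), v ∈ Set.Icc 1 h) →
        (1 - ε) * optRev D ≤ optRev (fun i => (D i).map (roundDown ε))) ∧
    -- The empirical Myerson auction on rounded values is a DSIC and IR mechanism for all samples.
    (∀ (n m : ℕ) (ε : ℝ), 0 < ε → ε < 1 → ∀ S : Fin m → Fin n → ℝ,
      (empiricalMyerson ε S).IsAdmissible) ∧
    -- Its revenue is near-optimal, with high probability and in expectation over the samples.
    ∃ C : ℝ, 0 < C ∧ ∀ (n : ℕ) (h ε : ℝ), 1 ≤ h → 0 < ε → ε < 1 →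
      ∀ D : Fin n → Measure ℝ, (∀ i, IsProbabilityMeasure (D i)) →
        (∀ i, ∀ᵐ v ∂(D i), v ∈ Set.Icc 1 h) →
        ∀ m : ℕ,
          (∀ γ : ℝ, 0 < γ → γ < 1 →
            C * (sampleSize n h ε + h / ε ^ 2 * Real.log (1 / γ)) ≤ m →
            sampleLaw D m {S | (empiricalMyerson ε S).rev D < (1 - C * ε) * optRev D}
              ≤ ENNReal.ofReal γ) ∧
          (C * sampleSize n h ε ≤ m →
            Integrable (fun S => (empiricalMyerson ε S).rev D) (sampleLaw D m) ∧
            (1 - C * ε) * optRev D ≤ ∫ S, (empiricalMyerson ε S).rev D ∂(sampleLaw D m)) := by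
  refine ⟨fun n h ε hh h0 h1 D hprob hD =>
    mul_optRev_le_optRev_map (zero_le_one.trans hh) h0 h1 hD,
    fun n m ε h0 h1 S => empiricalMyerson_isAdmissible h0 h1 S, 6, by norm_num, ?_⟩
  intro n h ε hh h0 h1 D hprob hD m
  rcases Nat.eq_zero_or_pos n with rfl | hn
  · -- Without bidders, there is no revenue.
    have hrev : ∀ M : Mechanism 0, M.rev D = 0 := fun M => by simp [Mechanism.rev]
    have hopt : optRev D = 0 := by
      obtain ⟨r, hr⟩ := optRev_set_nonempty D
      rw [optRev, show {r : ℝ | ∃ M : Mechanism 0, M.IsAdmissible ∧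
        Integrable (fun v => ∑ i, M.p v i) (Measure.pi D) ∧ r = M.rev D} = {0} from ?_, csSup_singleton]
      ext r
      simp only [Set.mem_ofPred_eq, hrev, Set.mem_singleton_iff]
      exact ⟨fun ⟨_, _, _, h⟩ => h, fun h => ⟨_, zero_isAdmissible, by simp, h⟩⟩
    refine ⟨fun γ _ _ _ => ?_, fun _ => ?_⟩
    · simp [hrev, hopt]
    · simp [hrev, hopt]
  have hO : 1 ≤ optRev D := one_le_optRev hh hD ⟨0, hn⟩
  have hN : 0 ≤ sampleSize n h ε := by
    have hA := one_le_levels hn hh h0 h1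
    have := Real.log_nonneg hA
    rw [sampleSize_eq hh h0]
    have : 0 < h := zero_lt_one.trans_le hh
    positivity
  refine ⟨fun γ hγ hγ1 hm => ?_, fun hm => ⟨integrable_rev_empiricalMyerson hh h0 h1 hD, ?_⟩⟩
  · have hL : 0 ≤ h / ε ^ 2 * Real.log (1 / γ) := by
      have := Real.log_pos ((one_lt_div hγ).2 hγ1)
      have : 0 < h := zero_lt_one.trans_le hh
      positivity
    have hle := measure_rev_lt_le hn hh h0 h1 hD hγ hγ1 (m := m) (by linarith)
    rw [measureReal_def, ← ENNReal.le_ofReal_iff_toReal_le (measure_ne_top _ _) hγ.le] at hle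
    refine (measure_mono fun S hS => ?_).trans hle
    have hS : (empiricalMyerson ε S).rev D < (1 - 6 * ε) * optRev D := hS
    exact hS.trans_le (mul_le_mul_of_nonneg_right (by linarith) (by linarith))
  · exact le_integral_rev hn hh h0 h1 hD (by linarith)
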